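/- Fix an integer $n\ge 2$. A translation-invariant total order (TITO) is a total order $\preceq$ on $\mathbb{Z}$ such that $a\preceq b\iff a+n\preceq b+n$. TITOs are partially ordered by containment of their sets of inversions, where an inversion of $\preceq$ is a pair $(a,b)$ with $a<b$ and $b\preceq a$ (up to simultaneous translation by multiples of $n$). The cyclic Tamari lattice $\mathsf{CTam}_{312}$ is the subposet of TITOs that are $312$-avoiding, i.e. for which there are no integers $a<b<c$ with $c\preceq a\preceq b$. It is a finite semidistributive lattice. For a finite semidistributive lattice $L$ and a join-irreducible $j\in L$ covering the unique element $j_*$, let $\kappa(j)=\max\{z\in L: z\wedge j=j_*\}$. Each cover relation $x\lessdot y$ is labelled by the unique join-irreducible $j$ with $j\vee x=y$ and $\kappa(j)\wedge y=x$; for $u\in L$ let $\mathcal{D}(u)$ be the set of labels of the cover relations $x\lessdot u$ and $\mathcal{U}(u)$ the set of labels of the cover relations $u\lessdot y$. Rowmotion is the unique bijection $\mathrm{Row}\colon L\to L$ with $\mathcal{D}(u)=\mathcal{U}(\mathrm{Row}(u))$ for all $u\in L$. For $x=\,\preceq\,\in\mathsf{CTam}_{312}$, the arc diagram $\mathcal{A}(x)$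 is the set of arcs $\gamma_{a,b}$ (indexed by pairs $a<b$ up to simultaneous translation by multiples of $n$) such that $b\preceq a$ is a cover relation of the total order $\preceq$. It is a noncrossing arc diagram: all its arcs $\gamma_{a,b}$ satisfy $b\le a+n$, there are no $\gamma_{a,b},\gamma_{c,d}\in\mathcal{A}(x)$ with representatives $a<c<b<d$, and distinct arcs have distinct starting points and distinct final points (modulo $n$). A set partition $\rho$ of a totally ordered set $X$ is noncrossing if for all $x_1<x_2<x_3<x_4$ in $X$ with $x_1\sim_\rho x_3$ and $x_2\sim_\rho x_4$ we have $x_1\sim_\rho x_2$. Its Kreweras complement $\mathrm{Krew}(\rho)$ is the coarsest set partition $\sigma$ of $X$ such that $\rho\sqcup\sigma^{\#}$ is a noncrossing partition of $X\sqcup X^{\#}$, where $X^{\#}=\{i^{\#}: i\in X\}$ is a disjoint copy of $X$, $\sigma^{\#}$ is the corresponding copy of $\sigma$, and $X\sqcup X^{\#}$ is totally ordered by $i<i^{\#}<j<j^{\#}$ for $i<j$ in $X$. Let $\mathrm{TINC}(\mathbb{Z})$ be the set of noncrossing partitions $\rho$ of $\mathbb{Z}$ with $a\sim_\rho b\iff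 a+n\sim_\rho b+n$. Let $\mathrm{NC}(B_n)$ be the set of noncrossing partitions of $[2n]=\{1,\dots,2n\}$ that are invariant under $180^\circ$ rotation of $2n$ equally spaced points on a circle, i.e. under $i\mapsto i+n$ modulo $2n$. Let $\mathcal{R}\colon\mathrm{TINC}(\mathbb{Z})\to\mathrm{NC}(B_n)$ send $\rho$ to the partition of $[2n]$ whose blocks are the reductions modulo $2n$ of the blocks of $\rho$. For $x\in\mathsf{CTam}_{312}$, let $\mathcal{P}(x)\in\mathrm{TINC}(\mathbb{Z})$ be the unwrapping of $\mathcal{A}(x)$, i.e. the finest element of $\mathrm{TINC}(\mathbb{Z})$ in which $a$ and $b$ lie in the same block whenever $\gamma_{a,b}\in\mathcal{A}(x)$. Proposition. The maps $\mathcal{P}\colon\mathsf{CTam}_{312}\to\mathrm{TINC}(\mathbb{Z})$ and $\mathcal{R}\colon\mathrm{TINC}(\mathbb{Z})\to\mathrm{NC}(B_n)$ are bijections, and for every $x\in\mathsf{CTam}_{312}$, $$\mathcal{P}(\mathrm{Row}(x))=\mathrm{Krew}(\mathcal{P}(x))\qquad\text{and}\qquad \mathcal{R}(\mathcal{P}(\mathrm{Row}(x)))=\mathrm{Krew}(\mathcal{R}(\mathcal{P}(x))).$$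 In particular, $\mathrm{Row}\colon\mathsf{CTam}_{312}\to\mathsf{CTam}_{312}$ is dynamically equivalent to $\mathrm{Krew}\colon\mathrm{NC}(B_n)\to\mathrm{NC}(B_n)$: both maps are bijections, and there is a bijection $\varphi\colon\mathsf{CTam}_{312}\to\mathrm{NC}(B_n)$ with $\mathrm{Krew}\circ\varphi=\varphi\circ\mathrm{Row}$. -/

import Mathlib

/-! ### Translation-invariant total orders and the cyclic Tamari lattice -/

/-- A translation-invariant total order (TITO) on `ℤ`, with period `n`. -/
@[ext] structure TITO (n : ℕ) where
  le : ℤ → ℤ → Prop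
  refl : ∀ a, le a a
  trans : ∀ a b c, le a b → le b c → le a c
  antisymm : ∀ a b, le a b → le b a → a = b
  total : ∀ a b, le a b ∨ le b a
  translate : ∀ a b, le a b ↔ le (a + n) (b + n)

namespace TITO

variable {n : ℕ}

/-- The inversions of a TITO, as the (translation-closed) set of all integer representatives `(a, b)`
of the reflection indices that are inversions. -/
def inv (t : TITO n) : Set (ℤ × ℤ) := {p | p.1 < p.2 ∧ t.le p.2 p.1}

theorem le_iff_of_inv_eq {s t : TITO n} (h : s.inv = t.inv) (a b : ℤ) : s.le a b ↔ t.le a b := by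
  have key : ∀ a b : ℤ, a < b → (s.le b a ↔ t.le b a) := by
    intro a b hab
    have := Set.ext_iff.mp h (a, b)
    simpa [inv, hab] using this
  rcases lt_trichotomy a b with hab | hab | hab
  · have k := key a b hab
    constructor
    · intro h1
      by_contra h2
      exact hab.ne (s.antisymm a b h1 (k.mpr ((t.total a b).resolve_left h2)))
    · intro h1
      by_contra h2
      exact hab.ne (t.antisymm a b h1 (k.mp ((s.total a b).resolve_left h2)))
  · subst hab
    exact ⟨fun _ => t.refl a, fun _ => s.refl a⟩
  · exact key b a hab

/-- The Dyer order: containment of inversion sets. -/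
instance : PartialOrder (TITO n) where
  le s t := s.inv ⊆ t.inv
  le_refl _ := subset_rfl
  le_trans _ _ _ := Set.Subset.trans
  le_antisymm s t h1 h2 := by
    apply TITO.ext
    funext a b
    exact propext (le_iff_of_inv_eq (Set.Subset.antisymm h1 h2) a b)

/-- No integers `a < b < c` satisfy `c ⪯ a ⪯ b`. -/
def Avoids312 (t : TITO n) : Prop :=
  ∀ a b c : ℤ, a < b → b < c → ¬ (t.le c a ∧ t.le a b)

/-- `x ⪯ y` is a cover relation of the total order. -/
def Covers (t : TITO n) (x y : ℤ) : Prop :=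
  x ≠ y ∧ t.le x y ∧ ∀ z, t.le x z → t.le z y → z = x ∨ z = y

/-- The lower walls, as the set of all integer representatives. -/
def lowerWalls (t : TITO n) : Set (ℤ × ℤ) := {p | p.1 < p.2 ∧ t.Covers p.2 p.1}

/-- The relation whose inversions are the common inversions of all members of `X`. -/
def infRel (X : Set (TITO n)) (a b : ℤ) : Prop :=
  a = b ∨ (a < b ∧ ∃ t ∈ X, t.le a b) ∨ (b < a ∧ ∀ t ∈ X, t.le a b)

end TITO

/-- The cyclic Tamari lattice: the `312`-avoiding TITOs, with the order induced by the Dyer order. -/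
def CTam (n : ℕ) : Type := {t : TITO n // t.Avoids312}

namespace CTam

variable {n : ℕ}

instance : PartialOrder (CTam n) := inferInstanceAs (PartialOrder {t : TITO n // t.Avoids312})

/-- Meets in the cyclic Tamari lattice are given by intersecting inversion sets. -/
instance : InfSet (CTam n) where
  sInf X :=
    ⟨{ le := TITO.infRel (Subtype.val '' X)
       refl := fun a => Or.inl rfl
       antisymm := by
         rintro a b (h | ⟨h, t, ht, h1⟩ | ⟨h, h1⟩) (h' | ⟨h', t', ht', h1'⟩ | ⟨h', h1'⟩)
         any_goals omega
         · exact t.antisymm a b h1 (h1' t ht)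
         · exact t'.antisymm a b (h1 t' ht') h1'
       total := by
         intro a b
         by_cases hE : ∃ t ∈ Subtype.val '' X, t.le a b
         · obtain ⟨t, ht, h⟩ := hE
           rcases lt_trichotomy a b with hab | hab | hab
           · exact Or.inl (Or.inr (Or.inl ⟨hab, t, ht, h⟩))
           · exact Or.inl (Or.inl hab)
           · by_cases hA : ∀ t ∈ Subtype.val '' X, t.le a b
             · exact Or.inl (Or.inr (Or.inr ⟨hab, hA⟩))
             · push Not at hA
               obtain ⟨t', ht', h'⟩ := hA
               exact Or.inr (Or.inr (Or.inl ⟨hab, t', ht', (t'.total a b).resolve_left h'⟩))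
         · push Not at hE
           have hE' : ∀ t ∈ Subtype.val '' X, t.le b a :=
             fun t ht => (t.total a b).resolve_left (hE t ht)
           rcases lt_trichotomy a b with hab | hab | hab
           · exact Or.inr (Or.inr (Or.inr ⟨hab, hE'⟩))
           · exact Or.inl (Or.inl hab)
           · by_cases hX : ∃ t, t ∈ Subtype.val '' X
             · obtain ⟨t, ht⟩ := hX
               exact Or.inr (Or.inr (Or.inl ⟨hab, t, ht, hE' t ht⟩))
             · exact Or.inl (Or.inr (Or.inr ⟨hab, fun t ht => absurd ⟨t, ht⟩ hX⟩))
       translate := by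
         intro a b
         unfold TITO.infRel
         refine or_congr (by omega) (or_congr (and_congr (by omega) ?_) (and_congr (by omega) ?_))
         · exact exists_congr fun t => and_congr_right fun _ => t.translate a b
         · exact forall_congr' fun t => forall_congr' fun _ => t.translate a b
       trans := by
         have av : ∀ t ∈ Subtype.val '' X, t.Avoids312 := by
           rintro _ ⟨t, -, rfl⟩
           exact t.2
         rintro p q r (h | ⟨h, t, ht, h1⟩ | ⟨h, h1⟩) (h' | ⟨h', t', ht', h1'⟩ | ⟨h', h1'⟩)
         · exact Or.inl (h.trans h')
         · subst h; exact Or.inr (Or.inl ⟨h', t', ht', h1'⟩)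
         · subst h; exact Or.inr (Or.inr ⟨h', h1'⟩)
         · subst h'; exact Or.inr (Or.inl ⟨h, t, ht, h1⟩)
         · refine Or.inr (Or.inl ⟨h.trans h', t, ht, ?_⟩)
           by_contra hn
           exact av t ht p q r h h' ⟨(t.total p r).resolve_left hn, h1⟩
         · rcases lt_trichotomy p r with hpr | hpr | hpr
           · exact Or.inr (Or.inl ⟨hpr, t, ht, t.trans _ _ _ h1 (h1' t ht)⟩)
           · exact Or.inl hpr
           · refine Or.inr (Or.inr ⟨hpr, fun u hu => ?_⟩)
             by_contra hn
             exact av u hu r p q hpr h ⟨h1' u hu, (u.total p r).resolve_left hn⟩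
         · subst h'; exact Or.inr (Or.inr ⟨h, h1⟩)
         · rcases lt_trichotomy p r with hpr | hpr | hpr
           · exact Or.inr (Or.inl ⟨hpr, t', ht', t'.trans _ _ _ (h1 t' ht') h1'⟩)
           · exact Or.inl hpr
           · exact absurd ⟨h1 t' ht', h1'⟩ (av t' ht' q r p h' hpr)
         · exact Or.inr (Or.inr ⟨h'.trans h, fun u hu => u.trans _ _ _ (h1 u hu) (h1' u hu)⟩) },
      by
        have av : ∀ t ∈ Subtype.val '' X, t.Avoids312 := by
          rintro _ ⟨t, -, rfl⟩
          exact t.2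
        rintro a b c hab hbc ⟨h1 | ⟨h1, -⟩ | ⟨-, h1⟩, h2 | ⟨-, t, ht, h2⟩ | ⟨h2, -⟩⟩
        any_goals omega
        exact av t ht a b c hab hbc ⟨h1 t ht, h2⟩⟩

theorem inv_sInf (X : Set (CTam n)) :
    (sInf X).1.inv = {p | p.1 < p.2 ∧ ∀ t ∈ X, p ∈ t.1.inv} := by
  ext ⟨a, b⟩
  constructor
  · rintro ⟨hab, h | ⟨h, -⟩ | ⟨-, h⟩⟩
    · simp only at hab h; omega
    · simp only at hab h; omega
    · exact ⟨hab, fun t ht => ⟨hab, h t.1 ⟨t, ht, rfl⟩⟩⟩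
  · rintro ⟨hab, h⟩
    refine ⟨hab, Or.inr (Or.inr ⟨hab, ?_⟩)⟩
    rintro _ ⟨t, ht, rfl⟩
    exact (h t ht).2

theorem isGLB_sInf' (X : Set (CTam n)) : IsGLB X (sInf X) := by
  constructor
  · intro t ht p hp
    have hp' : p ∈ (sInf X).1.inv := hp
    rw [inv_sInf] at hp'
    exact hp'.2 t ht
  · intro s hs p hp
    have key : p ∈ (sInf X).1.inv := by
      rw [inv_sInf]
      exact ⟨hp.1, fun t ht => hs ht hp⟩
    exact key

instance : CompleteLattice (CTam n) := completeLatticeOfInf (CTam n) isGLB_sInf'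

end CTam

/-! ### Rowmotion -/

section Rowmotion

variable {L : Type*} [CompleteLattice L]

/-- Complete semidistributivity; for a finite lattice this is ordinary semidistributivity. -/
def IsSemidistributive (L : Type*) [CompleteLattice L] : Prop :=
  (∀ x y : L, x ≤ y → ∃ m, IsGreatest {z | z ⊓ y = x} m) ∧
  (∀ x y : L, y ≤ x → ∃ m, IsLeast {z | z ⊔ y = x} m)

/-- (Complete) join-irreducibility. -/
def IsJoinIrr (j : L) : Prop := ∀ X : Set L, sSup X = j → j ∈ X

/-- `m = κ(j)`: with `j₀` the unique element covered by `j`, `m` is the maximum element of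
`{z | z ⊓ j = j₀}`. -/
def IsKappa (j m : L) : Prop :=
  ∃ j₀, j₀ ⋖ j ∧ (∀ x, x ⋖ j → x = j₀) ∧ IsGreatest {z | z ⊓ j = j₀} m

/-- The join-irreducible `j` labels the edge `x ⋖ y` of the Hasse diagram. -/
def IsEdgeLabel (x y j : L) : Prop :=
  x ⋖ y ∧ IsJoinIrr j ∧ j ⊔ x = y ∧ ∃ m, IsKappa j m ∧ m ⊓ y = x

/-- The canonical join representation `𝒟(u)`: labels of the edges down from `u`. -/
def downLabels (u : L) : Set L := {j | ∃ x, IsEdgeLabel x u j}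

/-- The canonical meet representation `𝒰(u)`: labels of the edges up from `u`. -/
def upLabels (u : L) : Set L := {j | ∃ y, IsEdgeLabel u y j}

/-- `f` is a rowmotion operator: a bijection with `𝒟(u) = 𝒰(f u)` for all `u`. -/
def IsRowmotion (f : L → L) : Prop :=
  Function.Bijective f ∧ ∀ u, downLabels u = upLabels (f u)

end Rowmotion

/-! ### Noncrossing partitions and Kreweras complement

Set partitions of `X` are encoded by their equivalence relations; `σ ≤ ρ` in `Setoid X` means that
`ρ` is coarser than `σ`. -/

section Noncrossing

variable {X : Type*} [LinearOrder X]

def IsNoncrossing (ρ : Setoid X) : Prop :=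
  ∀ x₁ x₂ x₃ x₄ : X, x₁ < x₂ → x₂ < x₃ → x₃ < x₄ → ρ x₁ x₃ → ρ x₂ x₄ → ρ x₁ x₂

/-- The set partition `ρ ⊔ σ^#` of `X ⊔ X^#`. The totally ordered set `X ⊔ X^#`, in which
`i < i^# < j` for `i < j`, is the lexicographic product `X ×ₗ Bool`, where `(i, false)` is `i` and
`(i, true)` is `i^#`. -/
def interleave (ρ σ : Setoid X) : Setoid (X ×ₗ Bool) where
  r p q := ((ofLex p).2 = false ∧ (ofLex q).2 = false ∧ ρ (ofLex p).1 (ofLex q).1) ∨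
    ((ofLex p).2 = true ∧ (ofLex q).2 = true ∧ σ (ofLex p).1 (ofLex q).1)
  iseqv := by
    refine ⟨fun p => ?_, fun {p q} h => ?_, fun {p q r} h h' => ?_⟩
    · cases hb : (ofLex p).2
      · exact Or.inl ⟨rfl, rfl, ρ.refl _⟩
      · exact Or.inr ⟨rfl, rfl, σ.refl _⟩
    · rcases h with ⟨h1, h2, h3⟩ | ⟨h1, h2, h3⟩
      · exact Or.inl ⟨h2, h1, ρ.symm h3⟩
      · exact Or.inr ⟨h2, h1, σ.symm h3⟩
    · rcases h with ⟨h1, h2, h3⟩ | ⟨h1, h2, h3⟩ <;> rcases h' with ⟨h1', h2', h3'⟩ | ⟨h1', h2', h3'⟩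
      · exact Or.inl ⟨h1, h2', ρ.trans h3 h3'⟩
      · rw [h2] at h1'; cases h1'
      · rw [h2] at h1'; cases h1'
      · exact Or.inr ⟨h1, h2', σ.trans h3 h3'⟩

/-- Kreweras complement: the coarsest `σ` such that `ρ ⊔ σ^#` is noncrossing. -/
def krew (ρ : Setoid X) : Setoid X := sSup {σ | IsNoncrossing (interleave ρ σ)}

/-- The set of `x` with `i < x ≤ j` or `j < x ≤ i` is a union of blocks of `ρ`. -/
def SepRel (ρ : Setoid X) (i j : X) : Prop := ∀ x y, ρ x y → ((i < x ↔ j < x) ↔ (i < y ↔ j < y))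

/-- The separation relation as a set partition. -/
def sepSetoid (ρ : Setoid X) : Setoid X where
  r := SepRel ρ
  iseqv := by
    refine ⟨fun i x y _ => by simp, fun {i j} h x y hxy => ?_, fun {i j k} h h' x y hxy => ?_⟩
    · have := h x y hxy; tauto
    · have := h x y hxy; have := h' x y hxy; tauto

theorem le_sepSetoid {ρ σ : Setoid X} (h : IsNoncrossing (interleave ρ σ)) : σ ≤ sepSetoid ρ := by
  have key : ∀ i j x y : X, σ i j → ρ x y → i < x → x ≤ j → i < y ∧ y ≤ j := by
    intro i j x y hij hxy h1 h2
    constructor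
    · by_contra hy
      push Not at hy
      have := h (toLex (y, false)) (toLex (i, true)) (toLex (x, false)) (toLex (j, true))
        (by simpa [Prod.Lex.toLex_lt_toLex, ← le_iff_lt_or_eq] using hy)
        (by simp [Prod.Lex.toLex_lt_toLex, h1])
        (by simpa [Prod.Lex.toLex_lt_toLex, ← le_iff_lt_or_eq] using h2)
        (Or.inl ⟨rfl, rfl, ρ.symm hxy⟩) (Or.inr ⟨rfl, rfl, hij⟩)
      rcases this with ⟨-, h3, -⟩ | ⟨h3, -, -⟩ <;> cases h3
    · by_contra hy
      push Not at hy
      have := h (toLex (i, true)) (toLex (x, false)) (toLex (j, true)) (toLex (y, false))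
        (by simp [Prod.Lex.toLex_lt_toLex, h1])
        (by simpa [Prod.Lex.toLex_lt_toLex, ← le_iff_lt_or_eq] using h2)
        (by simp [Prod.Lex.toLex_lt_toLex, hy])
        (Or.inr ⟨rfl, rfl, hij⟩) (Or.inl ⟨rfl, rfl, hxy⟩)
      rcases this with ⟨h3, -, -⟩ | ⟨-, h3, -⟩ <;> cases h3
  intro i j hij x y hxy
  have a1 := key i j x y hij hxy
  have a2 := key i j y x hij (ρ.symm hxy)
  have a3 := key j i x y (σ.symm hij) hxy
  have a4 := key j i y x (σ.symm hij) (ρ.symm hxy)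
  simp only [← not_lt] at a1 a2 a3 a4
  tauto

theorem isNoncrossing_sepSetoid {ρ : Setoid X} (h : IsNoncrossing ρ) :
    IsNoncrossing (interleave ρ (sepSetoid ρ)) := by
  rintro ⟨a, s⟩ ⟨b, t⟩ ⟨c, u⟩ ⟨d, v⟩ h1 h2 h3 h13 h24
  change toLex (a, s) < toLex (b, t) at h1
  change toLex (b, t) < toLex (c, u) at h2
  change toLex (c, u) < toLex (d, v) at h3
  rw [Prod.Lex.toLex_lt_toLex] at h1 h2 h3
  change (s = false ∧ u = false ∧ ρ a c) ∨ (s = true ∧ u = true ∧ SepRel ρ a c) at h13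
  change (t = false ∧ v = false ∧ ρ b d) ∨ (t = true ∧ v = true ∧ SepRel ρ b d) at h24
  change (s = false ∧ t = false ∧ ρ a b) ∨ (s = true ∧ t = true ∧ SepRel ρ a b)
  have tf : ¬ (true < false) := by decide
  rcases h13 with ⟨rfl, rfl, r1⟩ | ⟨rfl, rfl, r1⟩ <;>
    rcases h24 with ⟨rfl, rfl, r2⟩ | ⟨rfl, rfl, r2⟩
  · simp at h1 h2 h3
    exact Or.inl ⟨rfl, rfl, h a b c d h1 h2 h3 r1 r2⟩
  · simp [← le_iff_lt_or_eq, tf] at h1 h2 h3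
    have := r2 a c r1
    grind
  · simp [← le_iff_lt_or_eq, tf] at h1 h2 h3
    have := r1 b d r2
    grind
  · simp at h1 h2 h3
    refine Or.inr ⟨rfl, rfl, fun x y hxy => ?_⟩
    have e1 := r1 x y hxy
    have e2 := r2 x y hxy
    grind

theorem krew_eq {ρ : Setoid X} (h : IsNoncrossing ρ) : krew ρ = sepSetoid ρ :=
  le_antisymm (sSup_le fun _ => le_sepSetoid) (le_sSup (isNoncrossing_sepSetoid h))

/-- The supremum defining the Kreweras complement is attained. -/
theorem isGreatest_krew {ρ : Setoid X} (h : IsNoncrossing ρ) :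
    IsGreatest {σ | IsNoncrossing (interleave ρ σ)} (krew ρ) := by
  rw [krew_eq h]
  exact ⟨isNoncrossing_sepSetoid h, fun _ => le_sepSetoid⟩

theorem isNoncrossing_krew {ρ : Setoid X} (h : IsNoncrossing ρ) : IsNoncrossing (krew ρ) := by
  intro a b c d h1 h2 h3 h13 h24
  have := (isGreatest_krew h).1 (toLex (a, true)) (toLex (b, true)) (toLex (c, true))
    (toLex (d, true)) (by simp [Prod.Lex.toLex_lt_toLex, h1])
    (by simp [Prod.Lex.toLex_lt_toLex, h2]) (by simp [Prod.Lex.toLex_lt_toLex, h3])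
    (Or.inr ⟨rfl, rfl, h13⟩) (Or.inr ⟨rfl, rfl, h24⟩)
  rcases this with ⟨h4, -, -⟩ | ⟨-, -, h4⟩
  · cases h4
  · exact h4

end Noncrossing

/-- Translation-invariant noncrossing partitions of `ℤ`, with period `n`. -/
def TINC (n : ℕ) : Type :=
  {ρ : Setoid ℤ // IsNoncrossing ρ ∧ ∀ a b : ℤ, ρ a b ↔ ρ (a + n) (b + n)}

/-- Kreweras complement on translation-invariant noncrossing partitions. -/
def TINC.krew {n : ℕ} (ρ : TINC n) : TINC n :=
  ⟨_root_.krew ρ.1, isNoncrossing_krew ρ.2.1, by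
    intro a b
    rw [krew_eq ρ.2.1]
    constructor
    · intro h x y hxy
      have e := h (x - n) (y - n) ((ρ.2.2 _ _).mpr (by simpa using hxy))
      simpa only [lt_sub_iff_add_lt] using e
    · intro h x y hxy
      have e := h (x + n) (y + n) ((ρ.2.2 _ _).mp hxy)
      simpa only [add_lt_add_iff_right] using e⟩

/-- The totally ordered set `[N] = {1, …, N}`. -/
abbrev Seg (N : ℕ) : Type := Set.Icc (1 : ℤ) N

/-- Rotation by `180°` of `2N` equally spaced points `1, …, 2N` on a circle. -/
def rot {N : ℕ} (i : Seg (2 * N)) : Seg (2 * N) :=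
  ⟨if (i : ℤ) ≤ N then i + N else i - N, by
    have h1 := i.2.1
    have h2 := i.2.2
    push_cast at h2 ⊢
    constructor <;> split_ifs <;> omega⟩

theorem rot_rot {N : ℕ} (i : Seg (2 * N)) : rot (rot i) = i := by
  obtain ⟨i, h1, h2⟩ := i
  apply Subtype.ext
  simp only [rot]
  push_cast at h2
  split_ifs <;> omega

/-- Type `B_N` noncrossing partitions: noncrossing partitions of `[2N]` that are invariant under
`180°` rotation. -/
def NCB (N : ℕ) : Type :=
  {ρ : Setoid (Seg (2 * N)) // IsNoncrossing ρ ∧ ∀ i j, ρ i j ↔ ρ (rot i) (rot j)}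

theorem sep_rot {N : ℕ} {ρ : Setoid (Seg (2 * N))} (hρ : ∀ i j, ρ i j ↔ ρ (rot i) (rot j))
    {i j : Seg (2 * N)} (h : SepRel ρ i j) : SepRel ρ (rot i) (rot j) := by
  intro x y hxy
  have e := h (rot x) (rot y) ((hρ x y).mp hxy)
  obtain ⟨i, hi1, hi2⟩ := i
  obtain ⟨j, hj1, hj2⟩ := j
  obtain ⟨x, hx1, hx2⟩ := x
  obtain ⟨y, hy1, hy2⟩ := y
  simp only [rot, ← Subtype.coe_lt_coe] at e ⊢
  push_cast at hi2 hj2 hx2 hy2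
  clear hρ h hxy
  split_ifs at e ⊢ <;> omega

/-- Kreweras complement on type `B_N` noncrossing partitions. -/
def NCB.krew {N : ℕ} (ρ : NCB N) : NCB N :=
  ⟨_root_.krew ρ.1, isNoncrossing_krew ρ.2.1, by
    intro i j
    rw [krew_eq ρ.2.1]
    refine ⟨fun h => sep_rot ρ.2.2 h, fun h => ?_⟩
    have := sep_rot ρ.2.2 h
    rwa [rot_rot, rot_rot] at this⟩

theorem TINC.shift {n : ℕ} (ρ : TINC n) (k a b : ℤ) : ρ.1 a b ↔ ρ.1 (a + k * n) (b + k * n) := by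
  induction k using Int.induction_on generalizing a b with
  | zero => simp
  | succ k ih =>
    rw [ih, ρ.2.2]
    ring_nf
  | pred k ih =>
    rw [ih, ρ.2.2 (a + (-(k : ℤ) - 1) * n)]
    ring_nf

theorem TINC.shift_two {n : ℕ} (ρ : TINC n) (k a b : ℤ) :
    ρ.1 a b ↔ ρ.1 (a + 2 * n * k) (b + 2 * n * k) := by
  rw [ρ.shift (2 * k) a b]
  ring_nf

/-- Two elements of `[2n]` are related if they have related lifts to `ℤ`. -/
def TINC.RedRel {n : ℕ} (ρ : TINC n) (i j : Seg (2 * n)) : Prop :=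
  ∃ a b : ℤ, a ≡ i [ZMOD 2 * n] ∧ b ≡ j [ZMOD 2 * n] ∧ ρ.1 a b

theorem TINC.redRel_iff {n : ℕ} (ρ : TINC n) (i j : Seg (2 * n)) :
    ρ.RedRel i j ↔ ∃ k : ℤ, ρ.1 i (j + 2 * n * k) := by
  constructor
  · rintro ⟨a, b, ha, hb, h⟩
    obtain ⟨u, hu⟩ := ha.dvd
    obtain ⟨v, hv⟩ := hb.dvd
    refine ⟨u - v, ?_⟩
    rw [ρ.shift_two u] at h
    have e1 : (i : ℤ) = a + 2 * n * u := by linarith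
    have e2 : (j : ℤ) + 2 * n * (u - v) = b + 2 * n * u := by
      rw [mul_sub]; linarith
    rw [e1, e2]
    exact h
  · rintro ⟨k, h⟩
    exact ⟨i, j + 2 * n * k, rfl, by simp [Int.ModEq], h⟩

theorem TINC.redRel_symm {n : ℕ} (ρ : TINC n) {i j : Seg (2 * n)} (h : ρ.RedRel i j) :
    ρ.RedRel j i := by
  obtain ⟨a, b, ha, hb, h⟩ := h
  exact ⟨b, a, hb, ha, ρ.1.symm h⟩

theorem TINC.redRel_trans {n : ℕ} (ρ : TINC n) {i j k : Seg (2 * n)} (h : ρ.RedRel i j)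
    (h' : ρ.RedRel j k) : ρ.RedRel i k := by
  rw [redRel_iff] at *
  obtain ⟨u, h⟩ := h
  obtain ⟨v, h'⟩ := h'
  refine ⟨u + v, ρ.1.trans h ?_⟩
  rw [ρ.shift_two u] at h'
  convert h' using 1
  ring

/-- A pair at distance at least `n` lies in a block that is invariant under translation. -/
theorem TINC.rel_add {n : ℕ} (ρ : TINC n) {a b : ℤ} (hn : 0 < n) (hab : a + n ≤ b) (h : ρ.1 a b) :
    ∀ k : ℤ, ρ.1 a (a + k * n) := by
  have h1 : ρ.1 a (a + n) := by
    rcases hab.eq_or_lt with e | hlt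
    · rwa [e]
    · exact ρ.2.1 a (a + n) b (b + n) (by omega) hlt (by omega) h ((ρ.2.2 _ _).mp h)
  intro k
  induction k using Int.induction_on with
  | zero => simp
  | succ k ih =>
    refine ρ.1.trans ih ?_
    rw [ρ.shift k] at h1
    convert h1 using 1
    ring
  | pred k ih =>
    refine ρ.1.trans ih ?_
    rw [ρ.shift (-(k : ℤ) - 1)] at h1
    convert ρ.1.symm h1 using 1
    ring

theorem TINC.redRel_cases {n : ℕ} (ρ : TINC n) {i j : Seg (2 * n)} (hij : i < j)
    (h : ρ.RedRel i j) : ρ.1 i j ∨ ρ.1 (j - 2 * n) i := by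
  have hi := i.2.1
  have hj := j.2.2
  have hij' : (i : ℤ) < j := hij
  push_cast at hj
  have hn : 0 < n := by omega
  obtain ⟨k, h⟩ := (ρ.redRel_iff i j).mp h
  rcases lt_trichotomy k 0 with hk | rfl | hk
  · right
    rcases (show k ≤ -1 by omega).eq_or_lt with rfl | hk'
    · have := ρ.1.symm h
      convert this using 1
      ring
    · have h1 : (j : ℤ) + 2 * n * k + n ≤ i := by nlinarith
      have h2 := ρ.rel_add hn h1 (ρ.1.symm h) (-2 * k - 2)
      have h3 := ρ.1.trans (ρ.1.symm h2) (ρ.1.symm h)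
      convert h3 using 1
      ring
  · left
    simpa using h
  · left
    have h1 : (i : ℤ) + n ≤ j + 2 * n * k := by nlinarith
    have h2 := ρ.rel_add hn h1 h (2 * k)
    have h3 := ρ.1.trans (ρ.1.symm h2) h
    rw [ρ.shift_two k]
    convert h3 using 1
    ring

theorem TINC.redRel_of {n : ℕ} (ρ : TINC n) {i j : Seg (2 * n)} {a b : ℤ} (u v : ℤ)
    (ha : a = i + 2 * n * u) (hb : b = j + 2 * n * v) (h : ρ.1 a b) : ρ.RedRel i j :=
  ⟨a, b, by simp [ha, Int.ModEq], by simp [hb, Int.ModEq], h⟩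

theorem TINC.redRel_rot {n : ℕ} (ρ : TINC n) {i j : Seg (2 * n)} (h : ρ.RedRel i j) :
    ρ.RedRel (rot i) (rot j) := by
  have key : ∀ (a : ℤ) (i : Seg (2 * n)), a ≡ i [ZMOD 2 * n] → a + n ≡ rot i [ZMOD 2 * n] := by
    intro a i ha
    simp only [rot]
    split_ifs
    · exact ha.add_right _
    · refine (ha.add_right (n : ℤ)).trans ?_
      exact (Int.modEq_iff_dvd.mpr ⟨-1, by ring⟩)
  obtain ⟨a, b, ha, hb, h⟩ := h
  exact ⟨a + n, b + n, key a i ha, key b j hb, (ρ.2.2 _ _).mp h⟩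

/-- Reduction modulo `2n`, from translation-invariant noncrossing partitions of `ℤ` to type `B_n`
noncrossing partitions: the blocks are the reductions of the blocks. -/
def TINC.reduce {n : ℕ} (ρ : TINC n) : NCB n :=
  ⟨{ r := ρ.RedRel
     iseqv := ⟨fun i => ⟨i, i, rfl, rfl, ρ.1.refl _⟩, ρ.redRel_symm, ρ.redRel_trans⟩ }, by
    constructor
    · intro i j k l hij hjk hkl h13 h24
      have e1 : (i : ℤ) < j := hij
      have e2 : (j : ℤ) < k := hjk
      have e3 : (k : ℤ) < l := hkl
      have hi := i.2.1
      have hl := l.2.2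
      push_cast at hl
      change ρ.RedRel i k at h13
      change ρ.RedRel j l at h24
      change ρ.RedRel i j
      rcases ρ.redRel_cases (hij.trans hjk) h13 with a1 | a1 <;>
        rcases ρ.redRel_cases (hjk.trans hkl) h24 with a2 | a2
      · exact ρ.redRel_of 0 0 (by ring) (by ring) (ρ.2.1 i j k l e1 e2 e3 a1 a2)
      · have c := ρ.2.1 (l - 2 * n) i j k (by omega) e1 e2 a2 a1
        exact ρ.redRel_of 0 0 (by ring) (by ring) (ρ.1.trans (ρ.1.symm c) a2)
      · have a3 : ρ.1 k (i + 2 * n) := by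
          rw [ρ.shift_two (-1)]
          convert a1 using 1 <;> ring
        have c := ρ.2.1 j k l (i + 2 * n) e2 e3 (by omega) a2 a3
        exact ρ.redRel_symm (ρ.redRel_of 0 1 (by ring) (by ring) (ρ.1.trans c a3))
      · have c := ρ.2.1 (k - 2 * n) (l - 2 * n) i j (by omega) (by omega) e1 a1 a2
        exact ρ.redRel_of 0 0 (by ring) (by ring)
          (ρ.1.trans (ρ.1.symm a1) (ρ.1.trans c a2))
    · intro i j
      refine ⟨ρ.redRel_rot, fun h => ?_⟩
      have := ρ.redRel_rot h
      rwa [rot_rot, rot_rot] at this⟩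

/-! ### Arc diagrams and unwrapping -/

/-- A noncrossing arc diagram on the annulus with `n` marked points. A set of arcs `γ_{a,b}` is given
by the translation-closed set of all integer representatives `(a, b)`; here `a < b ≤ a + n`, no two
arcs have lifts that cross, and distinct arcs have distinct starting points and distinct final
points. -/
def IsNoncrossingArcDiagram (n : ℕ) (D : Set (ℤ × ℤ)) : Prop :=
  (∀ a b, (a, b) ∈ D ↔ (a + n, b + n) ∈ D) ∧
  (∀ a b, (a, b) ∈ D → a < b ∧ b ≤ a + n) ∧
  (∀ a b c d, (a, b) ∈ D → (c, d) ∈ D → ¬ (a < c ∧ c < b ∧ b < d)) ∧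
  (∀ a b c, (a, b) ∈ D → (a, c) ∈ D → b = c) ∧
  (∀ a b c, (a, c) ∈ D → (b, c) ∈ D → a = b)

/-- The arc diagram `𝒜(x)`: the arcs `γ_{a,b}` for the lower walls `(a, b)` of `x`. -/
def CTam.arcDiagram {n : ℕ} (x : CTam n) : Set (ℤ × ℤ) := x.1.lowerWalls

/-- `ρ_D`: the finest translation-invariant noncrossing partition in which `a` and `b` are in the
same block whenever `γ_{a,b} ∈ D`. -/
def unwrap (n : ℕ) (D : Set (ℤ × ℤ)) : TINC n :=
  ⟨sInf {ρ | IsNoncrossing ρ ∧ (∀ a b : ℤ, ρ a b ↔ ρ (a + n) (b + n)) ∧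
      ∀ a b, (a, b) ∈ D → ρ a b}, by
    constructor
    · intro a b c d h1 h2 h3 h13 h24 ρ hρ
      exact hρ.1 a b c d h1 h2 h3 (h13 ρ hρ) (h24 ρ hρ)
    · intro a b
      exact forall_congr' fun ρ => forall_congr' fun hρ => hρ.2.1 a b⟩

/-- The map `𝒫`, sending `x` to the unwrapping `ρ_{𝒜(x)}` of its arc diagram. -/
def CTam.toTINC {n : ℕ} (x : CTam n) : TINC n := unwrap n x.arcDiagram

/-- Dynamical equivalence of self-maps. -/
def DynamicallyEquivalent {X Y : Type*} (f : X → X) (g : Y → Y) : Prop :=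
  Function.Bijective f ∧ Function.Bijective g ∧
    ∃ φ : X → Y, Function.Bijective φ ∧ g ∘ φ = φ ∘ f

/-! ### Reach relations of 312-avoiding orders -/

namespace CTam

variable {n : ℕ}

/-! Write `a → b` for `x.reach a b`. Avoiding 312 says exactly that the integers reached from `a`
form an initial segment of `[a, ∞)`. So elements of `CTam n` are translation-invariant, reflexive,
transitive relations of this kind, and order and meet are containment and intersection. Call two
integers equivalent when their reaches have the same upper end, possibly infinite. The classes form
a noncrossing partition, `a → b` holds iff the class of `a` contains some `c ≥ b ≥ a`, and the lower
walls are the pairs of consecutive elements of a class. Hence `toTINC` is the partition into classes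
(`toTINC_eq`), and it is bijective.

The join-irreducibles are the elements `arcJoin n a b` with `a < b ≤ a + n`. A lower cover of `y`
deletes one lower wall `(a, b)` and has label `arcJoin n a b` (`isEdgeLabel_iff`). An upper cover of
`x` corresponds to a class with least element `a` and greatest element `b - 1`, again with label
`arcJoin n a b` (`mem_upLabels`). The Kreweras complement relates `i ≤ j` when `(i, j]` is a union
of blocks, and it turns consecutive pairs `a < b` into exactly such extreme pairs `a ≤ b - 1`
(`TINC.consecutive_iff`). So the map transported from it satisfies the equation defining rowmotion.
Since down-labels determine an element and the lattice is finite, it is a bijection and the only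
solution.

For the reduction, a pair at distance at least `n` forces its block to be invariant under
translation by `n`, so a partition can be recovered from its residues modulo `2n`
(`TINC.rel_iff_exists`, `NCB.unreduce`). Two points cut the circle into two arcs, and noncrossing
makes an arc a union of blocks on the circle iff a lift of one of the two arcs is a union of blocks
in `ℤ` (`TINC.reduce_krew`). -/

/-- The reflexive closure of the inversion relation. -/
def reach (x : CTam n) (a b : ℤ) : Prop := a ≤ b ∧ x.1.le b a

theorem reach_refl (x : CTam n) (a : ℤ) : x.reach a a := ⟨le_rfl, x.1.refl a⟩

theorem reach.trans {x : CTam n} {a b c : ℤ} (h : x.reach a b) (h' : x.reach b c) :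
    x.reach a c :=
  ⟨h.1.trans h'.1, x.1.trans _ _ _ h'.2 h.2⟩

/-- If `a` preceded `b`, then `c ⪯ a ⪯ b` would be a 312 pattern. -/
theorem reach.initial {x : CTam n} {a b c : ℤ} (h : x.reach a c) (hab : a ≤ b) (hbc : b ≤ c) :
    x.reach a b := by
  rcases hab.eq_or_lt with rfl | h1
  · exact x.reach_refl _
  rcases hbc.eq_or_lt with rfl | h2
  · exact h
  refine ⟨hab, ?_⟩
  by_contra hn
  exact x.2 a b c h1 h2 ⟨h.2, (x.1.total a b).resolve_right hn⟩

theorem reach_translate (x : CTam n) (a b : ℤ) : x.reach a b ↔ x.reach (a + n) (b + n) :=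
  and_congr (by omega) (x.1.translate b a)

theorem reach_shift (x : CTam n) (k a b : ℤ) :
    x.reach (a + k * n) (b + k * n) ↔ x.reach a b := by
  induction k using Int.induction_on generalizing a b with
  | zero => simp
  | succ k ih =>
    rw [← ih a b, x.reach_translate (a + k * n)]
    ring_nf
  | pred k ih =>
    rw [← ih a b, x.reach_translate (a + (-(k : ℤ) - 1) * n)]
    ring_nf

theorem reach_period {x : CTam n} {a : ℤ} (h : x.reach a (a + n)) (k : ℕ) :
    x.reach a (a + k * n) := by
  induction k with
  | zero => simpa using x.reach_refl a
  | succ k ih =>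
    have := (x.reach_shift k a (a + n)).mpr h
    refine ih.trans ?_
    convert this using 1
    push_cast
    ring

theorem reach_of_period (hn : 0 < n) {x : CTam n} {a b : ℤ} (h : x.reach a (a + n))
    (hab : a ≤ b) : x.reach a b := by
  -- Going up `b - a` periods passes `b`, because `n ≥ 1`.
  refine (reach_period h (b - a).toNat).initial hab ?_
  have : ((b - a).toNat : ℤ) = b - a := by omega
  rw [this]
  nlinarith

theorem reach_iff_not_le {x : CTam n} {a b : ℤ} (hab : a < b) : x.reach a b ↔ ¬ x.1.le a b := by
  constructor
  · intro h h'
    exact hab.ne (x.1.antisymm _ _ h' h.2)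
  · intro h
    exact ⟨hab.le, (x.1.total a b).resolve_left h⟩

theorem le_iff_reach {x y : CTam n} : x ≤ y ↔ ∀ a b, x.reach a b → y.reach a b := by
  constructor
  · rintro h a b ⟨h1, h2⟩
    rcases h1.eq_or_lt with rfl | h1
    · exact y.reach_refl _
    · have : (a, b) ∈ y.1.inv := h ⟨h1, h2⟩
      exact ⟨h1.le, this.2⟩
  · rintro h ⟨a, b⟩ ⟨h1, h2⟩
    exact ⟨h1, (h a b ⟨le_of_lt h1, h2⟩).2⟩

theorem ext_reach {x y : CTam n} (h : ∀ a b, x.reach a b ↔ y.reach a b) : x = y :=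
  le_antisymm (le_iff_reach.mpr fun a b => (h a b).mp) (le_iff_reach.mpr fun a b => (h a b).mpr)

/-- A `312`-avoiding order with prescribed reach relation. -/
def ofReach (R : ℤ → ℤ → Prop) (hrefl : ∀ a, R a a)
    (htrans : ∀ a b c, a ≤ b → b ≤ c → R a b → R b c → R a c)
    (hinit : ∀ a b c, a ≤ b → b ≤ c → R a c → R a b)
    (hshift : ∀ a b, R a b ↔ R (a + n) (b + n)) : CTam n :=
  ⟨{ le := fun a b => (b ≤ a ∧ R b a) ∨ (a < b ∧ ¬ R a b)
     refl := fun a => Or.inl ⟨le_rfl, hrefl a⟩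
     antisymm := by
       rintro a b (⟨h1, h2⟩ | ⟨h1, h2⟩) (⟨h3, h4⟩ | ⟨h3, h4⟩)
       · omega
       · exact absurd h2 h4
       · exact absurd h4 h2
       · omega
     total := by
       intro a b
       rcases lt_trichotomy a b with h | h | h <;> by_cases h' : R a b <;> by_cases h'' : R b a
       any_goals subst h
       all_goals grind
     trans := by
       rintro a b c (⟨h1, h2⟩ | ⟨h1, h2⟩) (⟨h3, h4⟩ | ⟨h3, h4⟩)
       · exact Or.inl ⟨h3.trans h1, htrans _ _ _ h3 h1 h4 h2⟩
       · rcases le_or_gt c a with h | h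
         · by_cases hR : R c a
           · exact Or.inl ⟨h, hR⟩
           · exact absurd (hinit b c a h3.le h h2) h4
         · exact Or.inr ⟨h, fun hR => h4 (htrans _ _ _ h1 h.le h2 hR)⟩
       · rcases le_or_gt c a with h | h
         · exact Or.inl ⟨h, hinit _ _ _ h h1.le h4⟩
         · refine Or.inr ⟨h, fun hR => h2 (htrans _ _ _ h.le h3 hR h4)⟩
       · exact Or.inr ⟨h1.trans h3, fun hR => h2 (hinit _ _ _ h1.le h3.le hR)⟩
     translate := fun a b => or_congr (and_congr (by omega) (hshift b a))
       (and_congr (by omega) (not_congr (hshift a b))) }, by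
    rintro a b c h1 h2 ⟨⟨-, h3⟩ | ⟨h3, -⟩, ⟨h4, -⟩ | ⟨-, h4⟩⟩
    any_goals omega
    exact h4 (hinit _ _ _ h1.le h2.le h3)⟩

theorem reach_ofReach {R : ℤ → ℤ → Prop} {hrefl htrans hinit hshift} (a b : ℤ) :
    (ofReach (n := n) R hrefl htrans hinit hshift).reach a b ↔ a ≤ b ∧ R a b := by
  constructor
  · rintro ⟨h, ⟨-, h'⟩ | ⟨h', -⟩⟩
    · exact ⟨h, h'⟩
    · omega
  · rintro ⟨h, h'⟩
    exact ⟨h, Or.inl ⟨h, h'⟩⟩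

theorem reach_inf (x y : CTam n) (a b : ℤ) : (x ⊓ y).reach a b ↔ x.reach a b ∧ y.reach a b := by
  constructor
  · exact fun h => ⟨le_iff_reach.mp inf_le_left _ _ h, le_iff_reach.mp inf_le_right _ _ h⟩
  · intro h
    let w : CTam n := ofReach (fun a b => x.reach a b ∧ y.reach a b)
      (fun a => ⟨x.reach_refl a, y.reach_refl a⟩)
      (fun a b c _ _ h h' => ⟨h.1.trans h'.1, h.2.trans h'.2⟩)
      (fun a b c h1 h2 h => ⟨h.1.initial h1 h2, h.2.initial h1 h2⟩)
      (fun a b => and_congr (x.reach_translate a b) (y.reach_translate a b))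
    have hw : w ≤ x ⊓ y := le_inf (le_iff_reach.mpr fun a b h => ((reach_ofReach a b).mp h).2.1)
      (le_iff_reach.mpr fun a b h => ((reach_ofReach a b).mp h).2.2)
    exact le_iff_reach.mp hw a b ((reach_ofReach a b).mpr ⟨h.1.1, h⟩)

/-- After translating the source into `[0, n)`, only targets up to one period away matter: reaching
a full period means reaching everything above. So a finite window of the relation determines it. -/
theorem finite (hn : 0 < n) : Finite (CTam n) := by
  let f : CTam n → Set (Set.Icc (0 : ℤ) n × Set.Icc (0 : ℤ) (2 * n)) :=
    fun x => {p | x.reach p.1 p.2}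
  refine Finite.of_injective f fun x y hxy => ?_
  have key : ∀ a b : ℤ, 0 ≤ a → a ≤ n → 0 ≤ b → b ≤ 2 * n → (x.reach a b ↔ y.reach a b) := by
    intro a b h1 h2 h3 h4
    exact Set.ext_iff.mp hxy (⟨a, h1, h2⟩, ⟨b, h3, h4⟩)
  have hle : ∀ x y : CTam n, (∀ a b : ℤ, 0 ≤ a → a ≤ n → 0 ≤ b → b ≤ 2 * n →
      (x.reach a b → y.reach a b)) → x ≤ y := by
    intro x y key
    refine le_iff_reach.mpr fun a b h => ?_
    have h0 : (0 : ℤ) < n := by exact_mod_cast hn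
    have h1 := Int.emod_nonneg a h0.ne'
    have h2 := Int.emod_lt_of_pos a h0
    have h3 : a = a % n + (a / n) * n := by rw [mul_comm]; exact (Int.emod_add_mul_ediv a n).symm
    set r := a % n
    set q := a / n
    obtain ⟨b, rfl⟩ : ∃ b', b = b' + q * n := ⟨b - q * n, by ring⟩
    rw [h3, reach_shift] at h ⊢
    have hrb := h.1
    by_cases hb : b ≤ r + n
    · exact key r b h1 h2.le (by omega) (by omega) h
    · exact reach_of_period hn
        (key r (r + n) h1 h2.le (by omega) (by omega) (h.initial (by omega) (by omega))) hrb
  exact le_antisymm (hle x y fun a b h1 h2 h3 h4 => (key a b h1 h2 h3 h4).mp)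
    (hle y x fun a b h1 h2 h3 h4 => (key a b h1 h2 h3 h4).mpr)

/-! ### Fibres and lower walls -/

/-- Two integers are in the same fibre if they have the same upper end of their reach. -/
def fib (x : CTam n) : Setoid ℤ where
  r a b := ∀ c, a ≤ c → b ≤ c → (x.reach a c ↔ x.reach b c)
  iseqv := by
    have aux : ∀ a b : ℤ, a ≤ b → (∀ c, a ≤ c → b ≤ c → (x.reach a c ↔ x.reach b c)) →
        x.reach a b := fun a b hab h => (h b hab le_rfl).mpr (x.reach_refl b)
    refine ⟨fun a c _ _ => Iff.rfl, fun h c h1 h2 => (h c h2 h1).symm,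
      fun {a b d} h h' c h1 h2 => ?_⟩
    by_cases hb : b ≤ c
    · exact (h c h1 hb).trans (h' c hb h2)
    -- Here `c` lies below the middle point `b`; both outer points reach `b`, hence both reach `c`.
    · push Not at hb
      have e1 := aux a b (h1.trans hb.le) h
      have e2 := aux d b (h2.trans hb.le) fun c h1 h2 => (h' c h2 h1).symm
      exact ⟨fun _ => e2.initial h2 hb.le, fun _ => e1.initial h1 hb.le⟩

theorem reach_of_fib {x : CTam n} {a b : ℤ} (hab : a ≤ b) (h : x.fib a b) : x.reach a b :=
  (h b hab le_rfl).mpr (x.reach_refl b)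

theorem fib_iff_of_le {x : CTam n} {a b : ℤ} (hab : a ≤ b) :
    x.fib a b ↔ x.reach a b ∧ ∀ c, x.reach a c → b ≤ c → x.reach b c := by
  constructor
  · exact fun h => ⟨reach_of_fib hab h, fun c h1 h2 => (h c h1.1 h2).mp h1⟩
  · exact fun h c _ h2 => ⟨fun h3 => h.2 c h3 h2, fun h3 => h.1.trans h3⟩

theorem isNoncrossing_fib (x : CTam n) : IsNoncrossing x.fib := by
  intro a b c d h1 h2 h3 h13 h24
  have r1 := reach_of_fib (h1.trans h2).le h13
  have r2 := reach_of_fib (h2.trans h3).le h24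
  rw [fib_iff_of_le h1.le]
  refine ⟨r1.initial h1.le h2.le, fun e he hbe => ?_⟩
  by_cases hce : c ≤ e
  · exact (r2.initial h2.le h3.le).trans ((h13 e he.1 hce).mp he)
  · exact r2.initial hbe (by omega)

theorem fib_translate (x : CTam n) (a b : ℤ) : x.fib a b ↔ x.fib (a + n) (b + n) := by
  constructor
  · intro h c h1 h2
    have := h (c - n) (by omega) (by omega)
    rw [x.reach_translate, x.reach_translate b] at this
    simpa using this
  · intro h c h1 h2
    rw [x.reach_translate, x.reach_translate b]
    exact h (c + n) (by omega) (by omega)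

/-- The fibres of a `312`-avoiding order form a translation-invariant noncrossing partition. -/
def fibres (x : CTam n) : TINC n := ⟨x.fib, x.isNoncrossing_fib, x.fib_translate⟩

/-- The last point reached from `a` lies in the fibre of `a`; if there is none, the fibre contains
every `a + k * n`. Consequently the fibres determine the order. -/
theorem reach_iff_exists_fib (hn : 0 < n) {x : CTam n} {a b : ℤ} :
    x.reach a b ↔ a ≤ b ∧ ∃ c, b ≤ c ∧ x.fib a c := by
  constructor
  · intro h
    refine ⟨h.1, ?_⟩
    by_cases hp : x.reach a (a + n)
    · have hle : b ≤ a + (b - a) * n := by nlinarith [h.1]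
      refine ⟨a + (b - a) * n, hle, (fib_iff_of_le (h.1.trans hle)).mpr
        ⟨reach_of_period hn hp (h.1.trans hle), fun c _ hc => reach_of_period hn ?_ hc⟩⟩
      have := (x.reach_shift (b - a) a (a + n)).mpr hp
      convert this using 1
      ring
    · obtain ⟨c, hc, hmax⟩ := Int.exists_greatest_of_bdd (P := fun c => x.reach a c)
        ⟨a + n, fun z hz => by
          by_contra hlt
          exact hp (hz.initial (by omega) (by omega))⟩ ⟨b, h⟩
      refine ⟨c, hmax b h, (fib_iff_of_le hc.1).mpr ⟨hc, fun d hd hcd => ?_⟩⟩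
      obtain rfl : d = c := le_antisymm (hmax d hd) hcd
      exact x.reach_refl d
  · rintro ⟨h, c, hc, hf⟩
    exact (reach_of_fib (h.trans hc) hf).initial h hc

/-- Consecutive elements of a fibre. -/
theorem mem_lowerWalls {x : CTam n} {a b : ℤ} :
    (a, b) ∈ x.1.lowerWalls ↔ a < b ∧ x.fib a b ∧ ∀ z, a < z → z < b → ¬ x.fib a z := by
  change (a < b ∧ x.1.Covers b a) ↔ _
  refine and_congr_right fun hab => ?_
  constructor
  · rintro ⟨-, hba, hz⟩
    have hr : x.reach a b := ⟨hab.le, hba⟩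
    constructor
    · refine (fib_iff_of_le hab.le).mpr ⟨hr, fun c hc hbc => ?_⟩
      by_contra hn
      rcases hbc.eq_or_lt with rfl | hbc
      · exact hn (x.reach_refl _)
      · rw [reach_iff_not_le hbc, not_not] at hn
        rcases hz c hn hc.2 with h | h <;> omega
    · intro z h1 h2 hf
      have hzb : x.reach z b := (hf b hab.le h2.le).mp hr
      rcases hz z hzb.2 (reach_of_fib h1.le hf).2 with h | h <;> omega
  · rintro ⟨hf, hz⟩
    have hr := reach_of_fib hab.le hf
    refine ⟨hab.ne', hr.2, fun z h1 h2 => ?_⟩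
    by_contra hne
    push Not at hne
    rcases lt_or_gt_of_ne hne.2 with h | h
    · have h3 : x.reach z b := ⟨(h.trans hab).le, h1⟩
      have h4 := (h3.initial h.le hab.le).2
      exact h.ne (x.1.antisymm _ _ h2 h4)
    rcases lt_or_gt_of_ne hne.1 with h' | h'
    · have h3 : x.reach z b := ⟨h'.le, h1⟩
      refine hz z h h' ((fib_iff_of_le h.le).mpr ⟨⟨h.le, h2⟩, fun c hc hzc => ?_⟩)
      by_cases hbc : b ≤ c
      · exact h3.trans ((hf c hc.1 hbc).mp hc)
      · exact h3.initial hzc (by omega)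
    · have h3 : x.reach a z := ⟨h.le, h2⟩
      have h4 := ((hf z h.le h'.le).mp h3).2
      exact h'.ne (x.1.antisymm _ _ h1 h4)

theorem lowerWalls_translate {x : CTam n} {a b : ℤ} :
    (a, b) ∈ x.1.lowerWalls ↔ (a + n, b + n) ∈ x.1.lowerWalls := by
  rw [mem_lowerWalls, mem_lowerWalls]
  refine and_congr (by omega) (and_congr (x.fib_translate a b) ⟨fun h z h1 h2 h3 => ?_,
    fun h z h1 h2 h3 => ?_⟩)
  · refine h (z - n) (by omega) (by omega) ?_
    rw [x.fib_translate]
    simpa using h3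
  · exact h (z + n) (by omega) (by omega) ((x.fib_translate a z).mp h3)

/-- A longer gap would force the fibre to be translation-invariant, and `a + n` would then lie
strictly inside the gap. -/
theorem le_add_of_mem_lowerWalls (hn : 0 < n) {x : CTam n} {a b : ℤ}
    (h : (a, b) ∈ x.1.lowerWalls) : b ≤ a + n := by
  rw [mem_lowerWalls] at h
  by_contra hlt
  have : x.fib a (a + 1 * n) := x.fibres.rel_add hn (show a + n ≤ b by omega) h.2.1 1
  exact h.2.2 (a + n) (by omega) (by omega) (by simpa using this)

theorem isNoncrossingArcDiagram_arcDiagram (hn : 0 < n) (x : CTam n) :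
    IsNoncrossingArcDiagram n x.arcDiagram := by
  refine ⟨fun a b => lowerWalls_translate, fun a b h => ⟨h.1, le_add_of_mem_lowerWalls hn h⟩,
    ?_, ?_, ?_⟩
  · rintro a b c d h h' ⟨h1, h2, h3⟩
    rw [arcDiagram, mem_lowerWalls] at h h'
    exact h.2.2 c h1 h2 (x.isNoncrossing_fib a c b d h1 h2 h3 h.2.1 h'.2.1)
  · intro a b c h h'
    rw [arcDiagram, mem_lowerWalls] at h h'
    by_contra hne
    rcases lt_or_gt_of_ne hne with hlt | hlt
    · exact h'.2.2 b h.1 hlt h.2.1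
    · exact h.2.2 c h'.1 hlt h'.2.1
  · intro a b c h h'
    rw [arcDiagram, mem_lowerWalls] at h h'
    by_contra hne
    rcases lt_or_gt_of_ne hne with hlt | hlt
    · exact h.2.2 b hlt h'.1 (x.fib.trans h.2.1 (x.fib.symm h'.2.1))
    · exact h'.2.2 a hlt h.1 (x.fib.trans h'.2.1 (x.fib.symm h.2.1))

/-- Intervals of `ℤ` are finite, so two elements of a fibre are joined by a chain of consecutive
ones; the induction is on their distance. -/
theorem fib_le_of_lowerWalls {x : CTam n} {ρ : Setoid ℤ}
    (h : ∀ a b, (a, b) ∈ x.1.lowerWalls → ρ a b) : x.fib ≤ ρ := by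
  have key : ∀ (m : ℕ) (a b : ℤ), b - a = m → x.fib a b → ρ a b := by
    intro m
    induction m using Nat.strong_induction_on with
    | _ m ih =>
      intro a b hm hf
      rcases (show a ≤ b by omega).eq_or_lt with rfl | hab
      · exact ρ.refl _
      by_cases hw : ∃ z, a < z ∧ z < b ∧ x.fib a z
      · obtain ⟨z, h1, h2, h3⟩ := hw
        exact ρ.trans (ih (z - a).toNat (by omega) a z (by omega) h3)
          (ih (b - z).toNat (by omega) z b (by omega) (x.fib.trans (x.fib.symm h3) hf))
      · push Not at hw
        exact h a b (mem_lowerWalls.mpr ⟨hab, hf, hw⟩)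
  intro a b hf
  rcases le_total a b with hab | hab
  · exact key (b - a).toNat a b (by omega) hf
  · exact ρ.symm (key (a - b).toNat b a (by omega) (x.fib.symm hf))

theorem toTINC_eq (x : CTam n) : x.toTINC = x.fibres := by
  apply Subtype.ext
  apply le_antisymm
  · exact sInf_le ⟨x.isNoncrossing_fib, x.fib_translate, fun a b h => (mem_lowerWalls.mp h).2.1⟩
  · exact le_sInf fun ρ hρ => fib_le_of_lowerWalls hρ.2.2

theorem toTINC_injective (hn : 0 < n) : Function.Injective (toTINC : CTam n → TINC n) := by
  intro x y h
  rw [toTINC_eq, toTINC_eq] at h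
  have h' : x.fib = y.fib := congrArg Subtype.val h
  refine ext_reach fun a b => ?_
  rw [reach_iff_exists_fib hn, reach_iff_exists_fib hn, h']

theorem toTINC_surjective : Function.Surjective (toTINC : CTam n → TINC n) := by
  intro ρ
  -- The order is forced by `reach_iff_exists_fib`. Noncrossing is what gives transitivity: if `a <
  -- b < d < e` with `a ∼ d` and `b ∼ e`, then `a ∼ e`.
  let x : CTam n := ofReach (fun a b => ∃ c, b ≤ c ∧ ρ.1 a c)
    (fun a => ⟨a, le_rfl, ρ.1.refl a⟩)
    (by
      rintro a b c hab hbc ⟨d, hd, h1⟩ ⟨e, he, h2⟩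
      by_cases hcd : c ≤ d
      · exact ⟨d, hcd, h1⟩
      refine ⟨e, he, ?_⟩
      rcases hab.eq_or_lt with rfl | hab
      · exact h2
      rcases hd.eq_or_lt with rfl | hd
      · exact ρ.1.trans h1 h2
      · exact ρ.1.trans (ρ.2.1 a b d e hab hd (by omega) h1 h2) h2)
    (fun a b c _ hbc ⟨d, hd, h⟩ => ⟨d, hbc.trans hd, h⟩)
    (by
      intro a b
      constructor
      · rintro ⟨c, hc, h⟩
        exact ⟨c + n, by omega, (ρ.2.2 a c).mp h⟩
      · rintro ⟨c, hc, h⟩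
        exact ⟨c - n, by omega, (ρ.2.2 _ _).mpr (by simpa using h)⟩)
  have hx : ∀ a b, x.reach a b ↔ a ≤ b ∧ ∃ c, b ≤ c ∧ ρ.1 a c := reach_ofReach
  refine ⟨x, ?_⟩
  rw [toTINC_eq]
  apply Subtype.ext
  have key : ∀ a b, a ≤ b → x.fib a b → ρ.1 a b := by
    intro a b hab hf
    rcases hab.eq_or_lt with rfl | hab
    · exact ρ.1.refl a
    obtain ⟨-, c, hc, h1⟩ := (hx a b).mp (reach_of_fib hab.le hf)
    rcases hc.eq_or_lt with rfl | hc
    · exact h1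
    have hac : x.reach a c := (hx a c).mpr ⟨(hab.trans hc).le, c, le_rfl, h1⟩
    obtain ⟨-, d, hd, h2⟩ := (hx b c).mp ((hf c hac.1 hc.le).mp hac)
    rcases hd.eq_or_lt with rfl | hd
    · exact ρ.1.trans h1 (ρ.1.symm h2)
    · exact ρ.2.1 a b c d hab hc hd h1 h2
  apply le_antisymm
  · intro a b hf
    rcases le_total a b with hab | hab
    · exact key a b hab hf
    · exact ρ.1.symm (key b a hab (x.fib.symm hf))
  · intro a b h c h1 h2
    rw [hx, hx]
    refine and_congr (by omega) (exists_congr fun d => and_congr_right fun _ => ?_)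
    exact ⟨fun h3 => ρ.1.trans (ρ.1.symm h) h3, fun h3 => ρ.1.trans h h3⟩

end CTam

/-! ### Join-irreducibles, cover relations and rowmotion labels -/

namespace CTam

variable {n : ℕ}

/-- The least element whose reach relation contains `(a, b)`, when `a < b ≤ a + n`. -/
def arcJoin (n : ℕ) (a b : ℤ) : CTam n :=
  -- The last disjunct covers `b = a + n`, where translates of `a` reach one another and hence
  -- everything above them.
  ofReach (fun c d => c = d ∨ ∃ k : ℤ, c = a + k * n ∧ (d ≤ b + k * n ∨ a + n ≤ b))
    (fun c => Or.inl rfl)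
    (by
      rintro c d e hcd hde (rfl | ⟨k, hk, h⟩) (rfl | ⟨l, hl, h'⟩)
      · exact Or.inl rfl
      · exact Or.inr ⟨l, hl, h'⟩
      · exact Or.inr ⟨k, hk, h⟩
      · rcases hcd.eq_or_lt with rfl | hlt
        · exact Or.inr ⟨l, hl, h'⟩
        -- Two distinct translates of `a` differ by at least `n`, so the first can reach the second
        -- only if `a + n ≤ b`.
        refine Or.inr ⟨k, hk, Or.inr ?_⟩
        rcases h with h | h
        · have h1 : k * n < l * n := by omega
          have h2 : k < l := lt_of_mul_lt_mul_right h1 (Int.natCast_nonneg n)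
          have h3 : (k + 1) * (n : ℤ) ≤ l * n :=
            mul_le_mul_of_nonneg_right (by omega) (Int.natCast_nonneg n)
          rw [add_mul, one_mul] at h3
          omega
        · exact h)
    (by
      rintro c d e hcd hde (rfl | ⟨k, hk, h⟩)
      · exact Or.inl (by omega)
      · exact Or.inr ⟨k, hk, h.imp_left hde.trans⟩)
    (by
      intro c d
      refine or_congr (by omega) ⟨?_, ?_⟩
      · rintro ⟨k, h⟩
        refine ⟨k + 1, ?_⟩
        rw [add_mul, one_mul]
        omega
      · rintro ⟨k, h⟩
        refine ⟨k - 1, ?_⟩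
        rw [sub_mul, one_mul]
        omega)

theorem reach_arcJoin {a b c d : ℤ} : (arcJoin n a b).reach c d ↔
    c ≤ d ∧ (c = d ∨ ∃ k : ℤ, c = a + k * n ∧ (d ≤ b + k * n ∨ a + n ≤ b)) :=
  reach_ofReach c d

theorem arcJoin_le_iff (hn : 0 < n) {a b : ℤ} (hab : a ≤ b) (hb : b ≤ a + n) {x : CTam n} :
    arcJoin n a b ≤ x ↔ x.reach a b := by
  rw [le_iff_reach]
  constructor
  · exact fun h => h a b (reach_arcJoin.mpr ⟨hab, Or.inr ⟨0, by simp⟩⟩)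
  · intro h c d hcd
    obtain ⟨h1, rfl | ⟨k, rfl, h2⟩⟩ := reach_arcJoin.mp hcd
    · exact x.reach_refl _
    have h3 := (x.reach_shift k a b).mpr h
    rcases h2 with h2 | h2
    · exact h3.initial h1 h2
    · refine reach_of_period hn ?_ h1
      obtain rfl : b = a + n := by omega
      convert h3 using 1
      ring

theorem arcJoin_shift (a b k : ℤ) : arcJoin n (a + k * n) (b + k * n) = arcJoin n a b := by
  refine ext_reach fun c d => ?_
  rw [reach_arcJoin, reach_arcJoin]
  refine and_congr_right fun _ => or_congr_right ⟨?_, ?_⟩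
  · rintro ⟨l, h⟩
    refine ⟨k + l, ?_⟩
    rw [add_mul]
    omega
  · rintro ⟨l, h⟩
    refine ⟨l - k, ?_⟩
    rw [sub_mul]
    omega

/-- Arcs of length at most `n` detect the order, since any longer reach already contains a full
period. -/
theorem le_of_forall_arcJoin_le (hn : 0 < n) {x y : CTam n}
    (h : ∀ a b : ℤ, a < b → b ≤ a + n → arcJoin n a b ≤ x → arcJoin n a b ≤ y) : x ≤ y := by
  have key : ∀ a b : ℤ, b ≤ a + n → x.reach a b → y.reach a b := by
    intro a b hb hr
    rcases hr.1.eq_or_lt with rfl | hab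
    · exact y.reach_refl _
    · rw [← arcJoin_le_iff hn hab.le hb] at hr ⊢
      exact h a b hab hb hr
  refine le_iff_reach.mpr fun a b hr => ?_
  by_cases hb : b ≤ a + n
  · exact key a b hb hr
  · exact reach_of_period hn (key a (a + n) le_rfl (hr.initial (by omega) (by omega))) hr.1

/-- Every element is the join of the `arcJoin`s below it, so an irreducible one must occur among
them. -/
theorem exists_of_isJoinIrr (hn : 0 < n) {j : CTam n} (hj : IsJoinIrr j) :
    ∃ a b : ℤ, a < b ∧ b ≤ a + n ∧ j = arcJoin n a b := by
  obtain ⟨a, b, h1, h2, h3, -⟩ :=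
    hj {w | ∃ a b : ℤ, a < b ∧ b ≤ a + n ∧ w = arcJoin n a b ∧ w ≤ j} (by
      apply le_antisymm
      · exact sSup_le fun w ⟨_, _, _, _, _, h⟩ => h
      · exact le_of_forall_arcJoin_le hn fun a b h1 h2 h3 => le_sSup ⟨a, b, h1, h2, rfl, h3⟩)
  exact ⟨a, b, h1, h2, h3⟩

theorem fib_shift {x : CTam n} (k a b : ℤ) : x.fib a b ↔ x.fib (a + k * n) (b + k * n) :=
  x.fibres.shift k a b

theorem arc_mem_lowerWalls (hn : 0 < n) {a b : ℤ} (hab : a < b) (hb : b ≤ a + n) :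
    (a, b) ∈ (arcJoin n a b).1.lowerWalls := by
  have h0 : (arcJoin n a b).reach a b := (arcJoin_le_iff hn hab.le hb).mp le_rfl
  -- No translate of `a` lies strictly between `a` and `a + n`, so points there reach only
  -- themselves.
  have hshort : ∀ z d, a < z → z < a + n → (arcJoin n a b).reach z d → z = d := by
    intro z d h1 h2 h3
    rcases (reach_arcJoin.mp h3).2 with h | ⟨k, hk, -⟩
    · exact h
    · have h4 : 0 * (n : ℤ) < k * n := by omega
      have h5 : k * (n : ℤ) < 1 * n := by omega
      have h6 := lt_of_mul_lt_mul_right h4 (Int.natCast_nonneg n)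
      have h7 := lt_of_mul_lt_mul_right h5 (Int.natCast_nonneg n)
      omega
  rw [mem_lowerWalls]
  refine ⟨hab, (fib_iff_of_le hab.le).mpr ⟨h0, fun c hc hbc => ?_⟩, fun z h1 h2 hf => ?_⟩
  · rcases hb.eq_or_lt with rfl | hb
    · refine reach_of_period hn ?_ hbc
      rwa [← reach_translate]
    · obtain ⟨-, h | ⟨k, hk, h | h⟩⟩ := reach_arcJoin.mp hc
      · omega
      · obtain rfl : c = b := by
          have : k * (n : ℤ) = 0 := by omega
          omega
        exact reach_refl _ _
      · omega
  · have := hshort z b h1 (by omega) ((hf b hab.le h2.le).mp h0)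
    omega

/-! ### Lower covers -/

/-- The lower cover obtained by removing the inversion `(a, b)` at a lower wall. -/
def cut (y : CTam n) (a b : ℤ) (h : (a, b) ∈ y.1.lowerWalls) : CTam n :=
  ofReach (fun c d => y.reach c d ∧ ∀ k : ℤ, c = a + k * n → d < b + k * n)
    (fun c => ⟨y.reach_refl c, fun k hk => by have := h.1; simp only at this; omega⟩)
    (by
      rintro c d e hcd hde ⟨h1, h2⟩ ⟨h3, h4⟩
      refine ⟨h1.trans h3, fun k hk => ?_⟩
      by_contra hlt
      have hd := h2 k hk
      rcases hcd.eq_or_lt with rfl | hcd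
      · exact hlt (h4 k hk)
      rw [mem_lowerWalls] at h
      -- A chain leading from `a + k * n` through `d` past `b + k * n` would put `d - k * n` in the
      -- fibre of `a`, strictly between the consecutive elements `a` and `b`.
      have hb : y.reach d (b + k * n) := h3.initial hd.le (by omega)
      subst hk
      refine h.2.2 (d - k * n) (by omega) (by omega) ?_
      rw [fib_shift k, sub_add_cancel, fib_iff_of_le hcd.le]
      refine ⟨h1, fun f hf hdf => ?_⟩
      by_cases hbf : b + k * n ≤ f
      · exact hb.trans ((((fib_shift k _ _).mp h.2.1) f hf.1 hbf).mp hf)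
      · exact hb.initial hdf (by omega))
    (fun c d e hcd hde ⟨h1, h2⟩ => ⟨h1.initial hcd hde, fun k hk => hde.trans_lt (h2 k hk)⟩)
    (fun c d => and_congr (y.reach_translate c d) ⟨fun h k hk => by
        have := h (k - 1)
        rw [sub_mul, one_mul] at this
        omega, fun h k hk => by
        have := h (k + 1)
        rw [add_mul, one_mul] at this
        omega⟩)

theorem reach_cut {y : CTam n} {a b c d : ℤ} {h : (a, b) ∈ y.1.lowerWalls} :
    (y.cut a b h).reach c d ↔ y.reach c d ∧ ∀ k : ℤ, c = a + k * n → d < b + k * n :=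
  (reach_ofReach c d).trans ⟨fun h => h.2, fun h => ⟨h.1.1, h⟩⟩

theorem cut_le {y : CTam n} {a b : ℤ} (h : (a, b) ∈ y.1.lowerWalls) : y.cut a b h ≤ y :=
  le_iff_reach.mpr fun _ _ h => (reach_cut.mp h).1

theorem not_reach_cut {y : CTam n} {a b : ℤ} (h : (a, b) ∈ y.1.lowerWalls) :
    ¬ (y.cut a b h).reach a b := by
  intro hr
  have := (reach_cut.mp hr).2 0 (by simp)
  simp at this

/-- A reach that misses `b` misses everything beyond. With `cut_le` and `not_reach_cut`, this makes
the cut the greatest element below `y` in which `a` does not reach `b`. -/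
theorem le_cut {x y : CTam n} {a b : ℤ} (h : (a, b) ∈ y.1.lowerWalls) (hxy : x ≤ y)
    (hx : ¬ x.reach a b) : x ≤ y.cut a b h := by
  refine le_iff_reach.mpr fun c d hr => reach_cut.mpr ⟨le_iff_reach.mp hxy c d hr, ?_⟩
  rintro k rfl
  by_contra hlt
  have hab := h.1
  simp only at hab
  exact hx ((x.reach_shift k a b).mp (hr.initial (by omega) (by omega)))

/-- A deleted relation `a → d` is restored as `a → b → d`: the second step survives the cut when `b
< a + n`, as `b` is then no translate of `a`. When `b = a + n`, periodicity restores it. -/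
theorem eq_of_cut_le (hn : 0 < n) {x y : CTam n} {a b : ℤ} (h : (a, b) ∈ y.1.lowerWalls)
    (hxy : x ≤ y) (hcx : y.cut a b h ≤ x) (hx : x.reach a b) : x = y := by
  refine le_antisymm hxy (le_iff_reach.mpr fun c d hr => ?_)
  by_cases hk : ∀ k : ℤ, c = a + k * n → d < b + k * n
  · exact le_iff_reach.mp hcx c d (reach_cut.mpr ⟨hr, hk⟩)
  push Not at hk
  obtain ⟨k, rfl, hd⟩ := hk
  obtain ⟨d, rfl⟩ : ∃ d', d = d' + k * n := ⟨d - k * n, by ring⟩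
  rw [reach_shift] at hr ⊢
  have hab := h.1
  have hbd : b ≤ d := by omega
  have hbn := le_add_of_mem_lowerWalls hn h
  rcases hbn.eq_or_lt with rfl | hbn
  · exact reach_of_period hn hx hr.1
  · refine hx.trans (le_iff_reach.mp hcx b d (reach_cut.mpr ⟨?_, fun l hl => ?_⟩))
    · exact ((mem_lowerWalls.mp h).2.1 d hr.1 hbd).mp hr
    · simp only at hab
      have h4 : 0 * (n : ℤ) < l * n := by omega
      have h5 : l * (n : ℤ) < 1 * n := by omega
      have h6 := lt_of_mul_lt_mul_right h4 (Int.natCast_nonneg n)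
      have h7 := lt_of_mul_lt_mul_right h5 (Int.natCast_nonneg n)
      omega

theorem cut_covBy (hn : 0 < n) {y : CTam n} {a b : ℤ} (h : (a, b) ∈ y.1.lowerWalls) :
    y.cut a b h ⋖ y := by
  have hy : y.reach a b := reach_of_fib h.1.le (mem_lowerWalls.mp h).2.1
  refine ⟨lt_of_le_of_ne (cut_le h) fun he => not_reach_cut h (by rw [he]; exact hy), fun x h1 h2 => ?_⟩
  by_cases hx : x.reach a b
  · exact h2.ne (eq_of_cut_le hn h h2.le h1.le hx)
  · exact h1.not_ge (le_cut h h2.le hx)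

/-- The lower walls generate `y`: they chain together along fibres, and initial segments supply the
rest. -/
theorem exists_lowerWall_of_lt (hn : 0 < n) {x y : CTam n} (hxy : x < y) :
    ∃ a b, (a, b) ∈ y.1.lowerWalls ∧ ¬ x.reach a b := by
  by_contra hcon
  push Not at hcon
  refine hxy.not_ge (le_iff_reach.mpr fun a b hr => ?_)
  obtain ⟨hab, c, hbc, hf⟩ := (reach_iff_exists_fib hn).mp hr
  refine reach.initial (c := c) ?_ hab hbc
  have key : ∀ (m : ℕ) (a c : ℤ), c - a = m → y.fib a c → x.reach a c := by
    intro m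
    induction m using Nat.strong_induction_on with
    | _ m ih =>
      intro a b hm hf
      rcases (show a ≤ b by omega).eq_or_lt with rfl | hab
      · exact x.reach_refl _
      by_cases hw : ∃ z, a < z ∧ z < b ∧ y.fib a z
      · obtain ⟨z, h1, h2, h3⟩ := hw
        exact (ih (z - a).toNat (by omega) a z (by omega) h3).trans
          (ih (b - z).toNat (by omega) z b (by omega) (y.fib.trans (y.fib.symm h3) hf))
      · push Not at hw
        exact hcon a b (mem_lowerWalls.mpr ⟨hab, hf, hw⟩)
  exact key (c - a).toNat a c (by omega) hf

theorem exists_cut_of_covBy (hn : 0 < n) {x y : CTam n} (hxy : x ⋖ y) :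
    ∃ a b, ∃ h : (a, b) ∈ y.1.lowerWalls, x = y.cut a b h := by
  obtain ⟨a, b, h, hx⟩ := exists_lowerWall_of_lt hn hxy.lt
  refine ⟨a, b, h, ?_⟩
  exact ((hxy.wcovBy.eq_or_eq (le_cut h hxy.le hx) (cut_le h)).resolve_right
    (cut_covBy hn h).lt.ne).symm

/-! ### Semidistributivity -/

theorem isSemidistributive (hn : 0 < n) : IsSemidistributive (CTam n) := by
  constructor
  · intro x y hxy
    have hxy' := le_iff_reach.mp hxy
    -- If `w ⊓ y = x` and `w` has `c → d`, then `a → c` in `x` gives `a → d` in `w`. For `(a, b)` in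
    -- `y` but not in `x`, this forces `d < b`, and then `a → d` in `x`. This necessary condition on
    -- `(c, d)` defines the maximum.
    let z : CTam n := ofReach
      (fun c d => ∀ a b, ¬ x.reach a b → y.reach a b → x.reach a c → x.reach a d)
      (fun c a b _ _ h => h)
      (fun c d e _ _ h h' a b h1 h2 h3 => h' a b h1 h2 (h a b h1 h2 h3))
      (fun c d e hcd hde h a b h1 h2 h3 => (h a b h1 h2 h3).initial (h3.1.trans hcd) hde)
      (by
        intro c d
        constructor
        · intro h a b h1 h2 h3
          have := h (a - n) (b - n)
          rw [x.reach_translate, x.reach_translate _ c, x.reach_translate _ d,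
            y.reach_translate] at this
          simp only [sub_add_cancel] at this
          exact this h1 h2 h3
        · intro h a b h1 h2 h3
          rw [x.reach_translate] at h1 h3 ⊢
          rw [y.reach_translate] at h2
          exact h _ _ h1 h2 h3)
    have hz : ∀ c d, z.reach c d ↔ c ≤ d ∧ ∀ a b, ¬ x.reach a b → y.reach a b →
      x.reach a c → x.reach a d := reach_ofReach
    refine ⟨z, ?_, ?_⟩
    · refine ext_reach fun c d => ?_
      rw [reach_inf, hz]
      constructor
      · rintro ⟨⟨hcd, h1⟩, h2⟩
        by_contra hn
        exact hn (h1 c d hn h2 (x.reach_refl c))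
      · exact fun h => ⟨⟨h.1, fun a b _ _ h3 => h3.trans h⟩, hxy' c d h⟩
    · intro w hw
      have hw' : ∀ a b, w.reach a b ∧ y.reach a b ↔ x.reach a b := by
        intro a b
        rw [← reach_inf, show w ⊓ y = x from hw]
      refine le_iff_reach.mpr fun c d hcd => (hz c d).mpr ⟨hcd.1, fun a b h1 h2 h3 => ?_⟩
      have h4 : w.reach a d := ((hw' a c).mpr h3).1.trans hcd
      refine (hw' a d).mp ⟨h4, ?_⟩
      by_cases hbd : b ≤ d
      · exact absurd ((hw' a b).mp ⟨h4.initial h2.1 hbd, h2⟩) h1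
      · exact h2.initial h4.1 (by omega)
  · intro x y hyx
    -- The minimum consists of the walls of `x` not supplied by `y`. If `z` also missed such a wall,
    -- both `z` and `y` would lie below the corresponding cut.
    refine ⟨sSup {j | ∃ a b, (a, b) ∈ x.1.lowerWalls ∧ ¬ y.reach a b ∧ j = arcJoin n a b},
      ?_, ?_⟩
    · have hle : sSup {j | ∃ a b, (a, b) ∈ x.1.lowerWalls ∧ ¬ y.reach a b ∧
          j = arcJoin n a b} ⊔ y ≤ x := by
        refine sup_le (sSup_le ?_) hyx
        rintro _ ⟨a, b, h, -, rfl⟩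
        rw [arcJoin_le_iff hn h.1.le (le_add_of_mem_lowerWalls hn h)]
        exact reach_of_fib h.1.le (mem_lowerWalls.mp h).2.1
      by_contra hne
      obtain ⟨a, b, h, h'⟩ := exists_lowerWall_of_lt hn (lt_of_le_of_ne hle hne)
      refine h' ?_
      rw [← arcJoin_le_iff hn h.1.le (le_add_of_mem_lowerWalls hn h)]
      by_cases hy : y.reach a b
      · rw [← arcJoin_le_iff hn h.1.le (le_add_of_mem_lowerWalls hn h)] at hy
        exact hy.trans le_sup_right
      · refine le_trans (le_sSup ?_) le_sup_left
        exact ⟨a, b, h, hy, rfl⟩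
    · intro z hz
      have hz' : z ⊔ y = x := hz
      refine sSup_le ?_
      rintro _ ⟨a, b, h, hy, rfl⟩
      rw [arcJoin_le_iff hn h.1.le (le_add_of_mem_lowerWalls hn h)]
      by_contra hzr
      have h1 : z ≤ x := hz' ▸ le_sup_left
      have h2 : z ⊔ y ≤ x.cut a b h := sup_le (le_cut h h1 hzr) (le_cut h hyx hy)
      rw [hz'] at h2
      exact (cut_covBy hn h).lt.not_ge h2

/-! ### Join-irreducibles, kappa and edge labels -/

theorem isJoinIrr_arcJoin (hn : 0 < n) {a b : ℤ} (hab : a < b) (hb : b ≤ a + n) :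
    IsJoinIrr (arcJoin n a b) := by
  intro X hX
  by_contra hmem
  have hw := arc_mem_lowerWalls hn hab hb
  have hle : sSup X ≤ (arcJoin n a b).cut a b hw := by
    refine sSup_le fun x hx => ?_
    have hxj : x ≤ arcJoin n a b := hX ▸ le_sSup hx
    refine le_cut hw hxj fun hr => hmem ?_
    rw [← arcJoin_le_iff hn hab.le hb] at hr
    rwa [← le_antisymm hxj hr]
  rw [hX] at hle
  exact (cut_covBy hn hw).lt.not_ge hle

theorem covBy_arcJoin_iff (hn : 0 < n) {a b : ℤ} (hab : a < b) (hb : b ≤ a + n) {x : CTam n} :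
    x ⋖ arcJoin n a b ↔ x = (arcJoin n a b).cut a b (arc_mem_lowerWalls hn hab hb) := by
  have hw := arc_mem_lowerWalls hn hab hb
  constructor
  · intro h
    have hr : ¬ x.reach a b := by
      rw [← arcJoin_le_iff hn hab.le hb]
      exact h.lt.not_ge
    exact ((h.wcovBy.eq_or_eq (le_cut hw h.le hr) (cut_le hw)).resolve_right
      (cut_covBy hn hw).lt.ne).symm
  · rintro rfl
    exact cut_covBy hn hw

/-- This makes kappa concrete: `κ(arcJoin n a b)` is the greatest element in which the reach of `a`
ends exactly at `b - 1`. -/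
theorem inf_arcJoin_eq_iff (hn : 0 < n) {a b : ℤ} (hab : a < b) (hb : b ≤ a + n) {z : CTam n} :
    z ⊓ arcJoin n a b = (arcJoin n a b).cut a b (arc_mem_lowerWalls hn hab hb) ↔
      z.reach a (b - 1) ∧ ¬ z.reach a b := by
  have hw := arc_mem_lowerWalls hn hab hb
  have hj : (arcJoin n a b).reach a b := (arcJoin_le_iff hn hab.le hb).mp le_rfl
  have hj' := hj.initial (b := b - 1) (by omega) (by omega)
  constructor
  · intro h
    have h1 : ((arcJoin n a b).cut a b hw).reach a (b - 1) := by
      refine reach_cut.mpr ⟨hj', fun k hk => ?_⟩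
      have : k * (n : ℤ) = 0 := by omega
      omega
    have h2 := not_reach_cut hw
    rw [← h, reach_inf] at h1 h2
    exact ⟨h1.1, fun h3 => h2 ⟨h3, hj⟩⟩
  · rintro ⟨h1, h2⟩
    apply le_antisymm
    · exact le_cut hw inf_le_right fun h => h2 ((reach_inf _ _ _ _).mp h).1
    · refine le_inf (le_iff_reach.mpr fun c d h => ?_) (cut_le hw)
      obtain ⟨h3, h4⟩ := reach_cut.mp h
      obtain ⟨hcd, rfl | ⟨k, rfl, -⟩⟩ := reach_arcJoin.mp h3
      · exact z.reach_refl _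
      · have := h4 k rfl
        exact ((z.reach_shift k a (b - 1)).mpr h1).initial hcd (by omega)

theorem exists_isKappa (hn : 0 < n) {a b : ℤ} (hab : a < b) (hb : b ≤ a + n) :
    ∃ m, IsKappa (arcJoin n a b) m := by
  obtain ⟨m, hm⟩ := (isSemidistributive hn).1 _ _ (cut_le (arc_mem_lowerWalls hn hab hb))
  exact ⟨m, _, cut_covBy hn _, fun x hx => (covBy_arcJoin_iff hn hab hb).mp hx, hm⟩

theorem isGreatest_of_isKappa (hn : 0 < n) {a b : ℤ} (hab : a < b) (hb : b ≤ a + n) {m : CTam n}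
    (hm : IsKappa (arcJoin n a b) m) :
    IsGreatest {z : CTam n | z.reach a (b - 1) ∧ ¬ z.reach a b} m := by
  obtain ⟨j₀, hj, -, hm⟩ := hm
  rw [covBy_arcJoin_iff hn hab hb] at hj
  subst hj
  simpa only [inf_arcJoin_eq_iff hn hab hb] using hm

theorem isEdgeLabel_iff (hn : 0 < n) {x y j : CTam n} :
    IsEdgeLabel x y j ↔
      ∃ a b, ∃ h : (a, b) ∈ y.1.lowerWalls, x = y.cut a b h ∧ j = arcJoin n a b := by
  constructor
  · rintro ⟨hxy, hj, hjx, m, hm, hmy⟩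
    obtain ⟨a, b, h, rfl⟩ := exists_cut_of_covBy hn hxy
    refine ⟨a, b, h, rfl, ?_⟩
    obtain ⟨c, d, hcd, hd, rfl⟩ := exists_of_isJoinIrr hn hj
    have hm' := (isGreatest_of_isKappa hn hcd hd hm).1
    have hy : y.reach c d := (arcJoin_le_iff hn hcd.le hd).mp (hjx ▸ le_sup_left)
    have hx : ¬ (y.cut a b h).reach c d := by
      rw [← hmy, reach_inf]
      exact fun h => hm'.2 h.1
    have hx' : (y.cut a b h).reach c (d - 1) := by
      rw [← hmy, reach_inf]
      exact ⟨hm'.1, hy.initial (by omega) (by omega)⟩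
    -- The relation `c → d` is lost in the cut but `c → d - 1` is kept. So `d` is the first target
    -- lost from `c`, which makes `(c, d)` a translate of `(a, b)`.
    have hk : ∃ k : ℤ, c = a + k * n ∧ b + k * n ≤ d := by
      by_contra hcon
      push Not at hcon
      exact hx (reach_cut.mpr ⟨hy, hcon⟩)
    obtain ⟨k, rfl, hd'⟩ := hk
    have := (reach_cut.mp hx').2 k rfl
    obtain rfl : d = b + k * n := by omega
    exact arcJoin_shift a b k
  · rintro ⟨a, b, h, rfl, rfl⟩
    have hab : a < b := h.1
    have hb := le_add_of_mem_lowerWalls hn h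
    have hy : y.reach a b := reach_of_fib hab.le (mem_lowerWalls.mp h).2.1
    refine ⟨cut_covBy hn h, isJoinIrr_arcJoin hn hab hb, ?_, ?_⟩
    · refine eq_of_cut_le hn h (sup_le ((arcJoin_le_iff hn hab.le hb).mpr hy) (cut_le h))
        le_sup_right ?_
      exact (arcJoin_le_iff hn hab.le hb).mp le_sup_left
    · obtain ⟨m, hm⟩ := exists_isKappa hn hab hb
      refine ⟨m, hm, ?_⟩
      have hm' := isGreatest_of_isKappa hn hab hb hm
      apply le_antisymm
      · exact le_cut h inf_le_right fun hr => hm'.1.2 ((reach_inf _ _ _ _).mp hr).1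
      · refine le_inf (hm'.2 ⟨reach_cut.mpr ⟨hy.initial (by omega) (by omega), fun k hk => ?_⟩,
          not_reach_cut h⟩) (cut_le h)
        have : k * (n : ℤ) = 0 := by omega
        omega

theorem mem_downLabels (hn : 0 < n) {y j : CTam n} :
    j ∈ downLabels y ↔ ∃ a b, (a, b) ∈ y.1.lowerWalls ∧ j = arcJoin n a b := by
  change (∃ x, IsEdgeLabel x y j) ↔ _
  simp only [isEdgeLabel_iff hn]
  constructor
  · rintro ⟨_, a, b, h, -, h'⟩
    exact ⟨a, b, h, h'⟩
  · rintro ⟨a, b, h, h'⟩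
    exact ⟨_, a, b, h, rfl, h'⟩

/-- An element is the join of its down-labels: otherwise that join would miss one of its lower
walls. -/
theorem downLabels_injective (hn : 0 < n) :
    Function.Injective (downLabels : CTam n → Set (CTam n)) := by
  have key : ∀ y : CTam n, sSup (downLabels y) = y := by
    intro y
    have hle : sSup (downLabels y) ≤ y := by
      refine sSup_le fun j hj => ?_
      obtain ⟨a, b, h, rfl⟩ := (mem_downLabels hn).mp hj
      rw [arcJoin_le_iff hn h.1.le (le_add_of_mem_lowerWalls hn h)]
      exact reach_of_fib h.1.le (mem_lowerWalls.mp h).2.1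
    by_contra hne
    obtain ⟨a, b, h, h'⟩ := exists_lowerWall_of_lt hn (lt_of_le_of_ne hle hne)
    rw [← arcJoin_le_iff hn h.1.le (le_add_of_mem_lowerWalls hn h)] at h'
    exact h' (le_sSup ((mem_downLabels hn).mpr ⟨a, b, h, rfl⟩))
  intro x y h
  rw [← key x, ← key y, h]

/-! ### Upper covers -/

/-- `a` and `b - 1` are the least and the greatest element of a fibre. -/
def IsFibreSpan (x : CTam n) (a b : ℤ) : Prop :=
  a < b ∧ x.reach a (b - 1) ∧ ¬ x.reach a b ∧ ∀ c < a, x.reach c a → x.reach c b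

theorem IsFibreSpan.le_add (hn : 0 < n) {x : CTam n} {a b : ℤ} (h : x.IsFibreSpan a b) :
    b ≤ a + n := by
  by_contra hlt
  exact h.2.2.1 (reach_of_period hn (h.2.1.initial (by omega) (by omega)) h.1.le)

theorem isFibreSpan_cut (hn : 0 < n) {y : CTam n} {a b : ℤ} (h : (a, b) ∈ y.1.lowerWalls) :
    (y.cut a b h).IsFibreSpan a b := by
  have hab : a < b := h.1
  have hb := le_add_of_mem_lowerWalls hn h
  have hy : y.reach a b := reach_of_fib hab.le (mem_lowerWalls.mp h).2.1
  refine ⟨hab, reach_cut.mpr ⟨hy.initial (by omega) (by omega), fun k hk => ?_⟩,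
    not_reach_cut h, fun c hc hca => ?_⟩
  · have : k * (n : ℤ) = 0 := by omega
    omega
  · obtain ⟨h1, h2⟩ := reach_cut.mp hca
    refine reach_cut.mpr ⟨h1.trans hy, ?_⟩
    rintro k rfl
    have h3 := h2 k rfl
    have h4 : k * (n : ℤ) < 0 * n := by omega
    have h5 := lt_of_mul_lt_mul_right h4 (Int.natCast_nonneg n)
    have h6 : (k + 1) * (n : ℤ) ≤ 0 * n :=
      mul_le_mul_of_nonneg_right (by omega) (Int.natCast_nonneg n)
    rw [add_mul, one_mul] at h6
    omega

/-- Adjoin `a → b`, with everything this entails. Any `c < a` that reaches `a` already reaches `b`,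
so no other source gains a relation, up to translation. -/
theorem exists_cut_eq_of_isFibreSpan (hn : 0 < n) {x : CTam n} {a b : ℤ}
    (hx : x.IsFibreSpan a b) : ∃ y : CTam n, ∃ h : (a, b) ∈ y.1.lowerWalls, x = y.cut a b h := by
  have hb := hx.le_add hn
  obtain ⟨hab, h1, h2, h3⟩ := hx
  have h3' : ∀ (k c : ℤ), c < a + k * n → x.reach c (a + k * n) → x.reach c (b + k * n) := by
    intro k c hc hr
    obtain ⟨c, rfl⟩ : ∃ c', c = c' + k * n := ⟨c - k * n, by ring⟩
    rw [reach_shift] at hr ⊢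
    exact h3 c (by omega) hr
  -- When `b = a + n`, the span condition extends the reach of `c` from one translate of `a` to the
  -- next, hence without bound.
  have hper : ∀ (k c d : ℤ), b = a + n → x.reach c (a + k * n) → c < a + k * n →
      a + k * n ≤ d → x.reach c d := by
    intro k c d e hr hc hd
    have : ∀ m : ℕ, x.reach c (a + (k + m) * n) := by
      intro m
      induction m with
      | zero => simpa using hr
      | succ m ih =>
        have hpos : 0 ≤ (m : ℤ) * n := by positivity
        have := h3' (k + m) c (by rw [add_mul]; omega) ih
        convert this using 1
        rw [e]
        push_cast
        ring
    refine (this (d - (a + k * n)).toNat).initial (by omega) ?_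
    have e : ((d - (a + k * n)).toNat : ℤ) = d - (a + k * n) := by omega
    rw [e]
    nlinarith
  let y : CTam n := ofReach
    (fun c d => x.reach c d ∨ ∃ k : ℤ, c = a + k * n ∧ (x.reach (b + k * n) d ∨ b = a + n))
    (fun c => Or.inl (x.reach_refl c))
    (by
      rintro c d e hcd hde (h | ⟨k, rfl, h⟩) (h' | ⟨l, rfl, h'⟩)
      · exact Or.inl (h.trans h')
      · rcases hcd.eq_or_lt with rfl | hcd
        · exact Or.inr ⟨l, rfl, h'⟩
        · rcases h' with h' | h'
          · exact Or.inl ((h3' l c hcd h).trans h')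
          · exact Or.inl (hper l c e h' h hcd hde)
      · exact Or.inr ⟨k, rfl, h.imp_left fun h => h.trans h'⟩
      · refine Or.inr ⟨k, rfl, ?_⟩
        by_cases e1 : b = a + n
        · exact Or.inr e1
        have h := h.resolve_right e1
        have h' := h'.resolve_right e1
        rcases h.1.eq_or_lt with e2 | hlt
        · have h4 : 0 * (n : ℤ) < (k - l + 1) * n := by rw [add_mul, sub_mul]; omega
          have h5 : (k - l) * (n : ℤ) < 0 * n := by rw [sub_mul]; omega
          have h6 := lt_of_mul_lt_mul_right h4 (Int.natCast_nonneg n)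
          have h7 := lt_of_mul_lt_mul_right h5 (Int.natCast_nonneg n)
          omega
        · exact Or.inl ((h3' l _ hlt h).trans h'))
    (by
      rintro c d e hcd hde (h | ⟨k, rfl, h⟩)
      · exact Or.inl (h.initial hcd hde)
      · by_cases hd : b + k * n ≤ d
        · exact Or.inr ⟨k, rfl, h.imp_left fun h => h.initial hd hde⟩
        · refine Or.inl (((x.reach_shift k _ _).mpr h1).initial hcd (by omega)))
    (by
      intro c d
      refine or_congr (x.reach_translate c d) ⟨?_, ?_⟩
      · rintro ⟨k, rfl, h⟩
        refine ⟨k + 1, by ring, h.imp_left fun h => ?_⟩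
        rw [x.reach_translate] at h
        convert h using 1
        ring
      · rintro ⟨k, hk, h⟩
        refine ⟨k - 1, by rw [sub_mul]; omega, h.imp_left fun h => ?_⟩
        rw [x.reach_translate]
        convert h using 1
        ring)
  have hy : ∀ c d, y.reach c d ↔ c ≤ d ∧ (x.reach c d ∨
    ∃ k : ℤ, c = a + k * n ∧ (x.reach (b + k * n) d ∨ b = a + n)) := reach_ofReach
  have hyab : y.reach a b := (hy a b).mpr
    ⟨hab.le, Or.inr ⟨0, by simp, Or.inl (by simpa using x.reach_refl b)⟩⟩
  have hw : (a, b) ∈ y.1.lowerWalls := by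
    refine mem_lowerWalls.mpr ⟨hab, (fib_iff_of_le hab.le).mpr ⟨hyab, fun c hc hbc => ?_⟩,
      fun z hz hzb hf => ?_⟩
    · obtain ⟨-, h | ⟨k, hk, h⟩⟩ := (hy a c).mp hc
      · exact absurd (h.initial hab.le hbc) h2
      · refine (hy b c).mpr ⟨hbc, ?_⟩
        have hk0 : k * (n : ℤ) = 0 := by omega
        rw [hk0, add_zero] at h
        refine h.imp id fun h => ⟨1, by simpa using h, Or.inr h⟩
    · have hzb' := (hf b hab.le hzb.le).mp hyab
      obtain ⟨-, h | ⟨k, hk, -⟩⟩ := (hy z b).mp hzb'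
      · exact h2 ((h1.initial hz.le (by omega)).trans h)
      · have h4 : 0 * (n : ℤ) < k * n := by omega
        have h5 : k * (n : ℤ) < 1 * n := by omega
        have h6 := lt_of_mul_lt_mul_right h4 (Int.natCast_nonneg n)
        have h7 := lt_of_mul_lt_mul_right h5 (Int.natCast_nonneg n)
        omega
  refine ⟨y, hw, ext_reach fun c d => ?_⟩
  rw [reach_cut]
  constructor
  · intro h
    refine ⟨(hy c d).mpr ⟨h.1, Or.inl h⟩, ?_⟩
    rintro k rfl
    by_contra hlt
    exact h2 ((x.reach_shift k a b).mp (h.initial (by omega) (by omega)))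
  · rintro ⟨h4, h5⟩
    obtain ⟨hcd, h | ⟨k, rfl, -⟩⟩ := (hy c d).mp h4
    · exact h
    · have := h5 k rfl
      exact ((x.reach_shift k a (b - 1)).mpr h1).initial hcd (by omega)

theorem mem_upLabels (hn : 0 < n) {x j : CTam n} :
    j ∈ upLabels x ↔ ∃ a b, x.IsFibreSpan a b ∧ j = arcJoin n a b := by
  change (∃ y, IsEdgeLabel x y j) ↔ _
  simp only [isEdgeLabel_iff hn]
  constructor
  · rintro ⟨y, a, b, h, rfl, h'⟩
    exact ⟨a, b, isFibreSpan_cut hn h, h'⟩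
  · rintro ⟨a, b, h, h'⟩
    obtain ⟨y, hy, h⟩ := exists_cut_eq_of_isFibreSpan hn h
    exact ⟨y, a, b, hy, h, h'⟩

theorem isFibreSpan_iff_fib (hn : 0 < n) {x : CTam n} {a b : ℤ} : x.IsFibreSpan a b ↔
    a < b ∧ x.fib a (b - 1) ∧ (∀ c < a, ¬ x.fib c a) ∧ ∀ c, b ≤ c → ¬ x.fib (b - 1) c := by
  refine and_congr_right fun hab => ?_
  constructor
  · rintro ⟨h1, h2, h3⟩
    have hf : x.fib a (b - 1) := by
      refine (fib_iff_of_le (by omega)).mpr ⟨h1, fun c hc hbc => ?_⟩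
      by_cases hcb : c ≤ b - 1
      · obtain rfl : c = b - 1 := by omega
        exact x.reach_refl _
      · exact absurd (hc.initial hab.le (by omega)) h2
    refine ⟨hf, fun c hc hca => ?_, fun c hbc hcf => ?_⟩
    · have hr := h3 c hc (reach_of_fib hc.le hca)
      exact h2 ((hca b hr.1 hab.le).mp hr)
    · exact h2 ((h1.trans (reach_of_fib (by omega) hcf)).initial hab.le hbc)
  · rintro ⟨hf, hmin, hmax⟩
    have h1 := reach_of_fib (show a ≤ b - 1 by omega) hf
    refine ⟨h1, fun hr => ?_, fun c hc hca => ?_⟩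
    · have := (hf b hab.le (by omega)).mp hr
      obtain ⟨-, d, hd, hbd⟩ := (reach_iff_exists_fib hn).mp this
      exact hmax d hd hbd
    · obtain ⟨-, d, hd, hcd⟩ := (reach_iff_exists_fib hn).mp hca
      by_cases hdb : b ≤ d
      · exact (reach_of_fib (by omega) hcd).initial (by omega) hdb
      -- The fibre of `c` has an element `d` in `[a, b - 1]`. By crossing or coincidence it is then
      -- the fibre of `a`, whose least element is `a > c`.
      exfalso
      rcases hd.eq_or_lt with rfl | had
      · exact hmin c hc hcd
      rcases (show d ≤ b - 1 by omega).eq_or_lt with rfl | hdb'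
      · exact hmin c hc (x.fib.trans hcd (x.fib.symm hf))
      · exact hmin c hc (x.isNoncrossing_fib c a d (b - 1) hc had hdb' hcd hf)

end CTam

/-! ### Kreweras complement of translation-invariant partitions -/

theorem sepRel_iff {X : Type*} [LinearOrder X] {ρ : Setoid X} {i j : X} (hij : i ≤ j) :
    SepRel ρ i j ↔ ∀ x y, ρ x y → i < x → x ≤ j → i < y ∧ y ≤ j := by
  constructor
  · intro h x y hxy h1 h2
    have := h x y hxy
    grind
  · intro h x y hxy
    have h1 := h x y hxy
    have h2 := h y x (ρ.symm hxy)
    grind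

/-- The open interval between consecutive elements of a block is a union of blocks. -/
theorem IsNoncrossing.sepRel_of_consecutive {ρ : Setoid ℤ} (hρ : IsNoncrossing ρ) {a b : ℤ}
    (hab : a < b) (h : ρ a b) (hz : ∀ z, a < z → z < b → ¬ ρ a z) : SepRel ρ a (b - 1) := by
  rw [sepRel_iff (by omega)]
  intro x y hxy h1 h2
  by_contra hcon
  have hxa : ¬ ρ a x := hz x h1 (by omega)
  by_cases hya : y = a
  · subst hya
    exact hxa (ρ.symm hxy)
  by_cases hyb : y = b
  · subst hyb
    exact hxa (ρ.trans h (ρ.symm hxy))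
  rcases lt_or_gt_of_ne hya with hlt | hgt
  · have := hρ y a x b hlt h1 (by omega) (ρ.symm hxy) h
    exact hxa (ρ.trans (ρ.symm this) (ρ.symm hxy))
  · exact hxa (hρ a x b y h1 (by omega) (by omega) h hxy)

/-- Consecutive elements `a < b` of the blocks of `ρ` correspond to the least elements `a` and
greatest elements `b - 1` of the blocks of the Kreweras complement. -/
theorem TINC.consecutive_iff {n : ℕ} (hn : 0 < n) (ρ : TINC n) {a b : ℤ} :
    (a < b ∧ ρ.1 a b ∧ ∀ z, a < z → z < b → ¬ ρ.1 a z) ↔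
      a < b ∧ SepRel ρ.1 a (b - 1) ∧ (∀ c < a, ¬ SepRel ρ.1 c a) ∧
        ∀ c, b ≤ c → ¬ SepRel ρ.1 (b - 1) c := by
  refine and_congr_right fun hab => ?_
  constructor
  · rintro ⟨h, hz⟩
    refine ⟨ρ.2.1.sepRel_of_consecutive hab h hz, fun c hc hs => ?_, fun c hc hs => ?_⟩
    -- The interval `(c, a]` contains `a` but not its block-mate `b`.
    · have := (sepRel_iff hc.le).mp hs a b h hc le_rfl
      omega
    · have := (sepRel_iff (by omega)).mp hs b a (ρ.1.symm h) (by omega) hc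
      omega
  · rintro ⟨hs, hmin, hmax⟩
    have hz : ∀ z, a < z → z < b → ¬ ρ.1 a z := by
      intro z h1 h2 h
      have := (sepRel_iff (by omega)).mp hs z a (ρ.1.symm h) h1 (by omega)
      omega
    refine ⟨?_, hz⟩
    by_cases hex : ∃ z, a < z ∧ ρ.1 a z
    · obtain ⟨z, ⟨haz, hρ⟩, hleast⟩ := Int.exists_least_of_bdd
        (P := fun z => a < z ∧ ρ.1 a z) ⟨a, fun z h => h.1.le⟩ hex
      have hbz : b ≤ z := by
        by_contra hlt
        exact hz z haz (by omega) hρ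
      have hs' : SepRel ρ.1 a (z - 1) := ρ.2.1.sepRel_of_consecutive haz hρ
        fun w h1 h2 h3 => by
          have := hleast w ⟨h1, h3⟩
          omega
      have hs'' : SepRel ρ.1 (b - 1) (z - 1) :=
        (sepSetoid ρ.1).trans ((sepSetoid ρ.1).symm hs) hs'
      -- With `z` the successor of `a` in its block, `z - 1` and `b - 1` share a block of the
      -- complement; maximality of `b - 1` gives `z = b`.
      rcases hbz.eq_or_lt with rfl | hlt
      · exact hρ
      · exact absurd hs'' (hmax _ (by omega))
    · exfalso
      push Not at hex
      -- Here `a` is the greatest element of its block, which is therefore not translation-invariant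
      -- and has a least element `w`. Then `(w - 1, a]` is a union of blocks, against the minimality
      -- of `a`.
      obtain ⟨w, ⟨hwa, hρ⟩, hleast⟩ := Int.exists_least_of_bdd
        (P := fun z => z ≤ a ∧ ρ.1 a z) ⟨a - n, fun z h => by
          by_contra hlt
          have h1 := ρ.rel_add hn (show z + n ≤ a by omega) (ρ.1.symm h.2) 1
          have h2 := (ρ.2.2 _ _).mp (ρ.1.symm h.2)
          have h3 : ρ.1 z (z + n) := by simpa using h1
          exact hex (a + n) (by omega) (ρ.1.trans h.2 (ρ.1.trans h3 h2))⟩ ⟨a, le_rfl, ρ.1.refl a⟩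
      refine hmin (w - 1) (by omega) ((sepRel_iff (by omega)).mpr fun x y hxy h1 h2 => ?_)
      by_contra hcon
      by_cases hxa : ρ.1 a x
      · have h3 := ρ.1.trans hxa hxy
        by_cases hya : a < y
        · exact hex y hya h3
        · have := hleast y ⟨by omega, h3⟩
          omega
      · have hxw : x ≠ w := fun e => hxa (e ▸ hρ)
        have hxa' : x ≠ a := fun e => hxa (e ▸ ρ.1.refl a)
        by_cases hya : a < y
        · have := ρ.2.1 w x a y (by omega) (by omega) hya (ρ.1.symm hρ) hxy
          exact hxa (ρ.1.trans hρ this)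
        · have := ρ.2.1 y w x a (by omega) (by omega) (by omega) (ρ.1.symm hxy) (ρ.1.symm hρ)
          exact hxa (ρ.1.trans hρ (ρ.1.trans (ρ.1.symm this) (ρ.1.symm hxy)))

/-! ### Rowmotion as Kreweras complement -/

namespace CTam

variable {n : ℕ}

theorem downLabels_eq_upLabels (hn : 0 < n) {x y : CTam n} (h : y.toTINC = x.toTINC.krew) :
    downLabels x = upLabels y := by
  rw [toTINC_eq, toTINC_eq] at h
  have hf : y.fib = sepSetoid x.fib := by
    rw [← krew_eq x.isNoncrossing_fib]
    exact congrArg Subtype.val h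
  ext j
  rw [mem_downLabels hn, mem_upLabels hn]
  refine exists_congr fun a => exists_congr fun b => and_congr_left fun _ => ?_
  rw [mem_lowerWalls, isFibreSpan_iff_fib hn, hf]
  exact x.fibres.consecutive_iff hn

/-- Rowmotion, transported from the Kreweras complement. -/
theorem exists_row (hn : 0 < n) : ∃ Row : CTam n → CTam n,
    IsRowmotion Row ∧ (∀ f : CTam n → CTam n, IsRowmotion f → f = Row) ∧
      ∀ x : CTam n, (Row x).toTINC = x.toTINC.krew := by
  choose Row hRow using fun x : CTam n => toTINC_surjective x.toTINC.krew
  have hlab : ∀ x, downLabels x = upLabels (Row x) := fun x => downLabels_eq_upLabels hn (hRow x)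
  have hinj : Function.Injective Row := by
    intro x y h
    apply downLabels_injective hn
    rw [hlab, hlab, h]
  have := finite (n := n) hn
  have hbij : Function.Bijective Row := Finite.injective_iff_bijective.mp hinj
  refine ⟨Row, ⟨hbij, hlab⟩, fun f hf => funext fun x => ?_, hRow⟩
  -- Uniqueness: writing `f x = Row y`, the up-labels of this element are the down-labels of both
  -- `x` and `y`, so `x = y`.
  obtain ⟨y, hy⟩ := hbij.2 (f x)
  have : downLabels x = downLabels y := by rw [hf.2, hlab, hy]
  rw [← hy, downLabels_injective hn this]

end CTam

/-! ### Reduction modulo `2n` -/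

namespace TINC

variable {n : ℕ}

/-- A block containing elements at distance at least `n` is invariant under translation. -/
theorem rel_add_of_rel (hn : 0 < n) (ρ : TINC n) {a b : ℤ} (h : ρ.1 a b)
    (hab : a + n ≤ b ∨ b + n ≤ a) (k : ℤ) : ρ.1 a (a + k * n) := by
  rcases hab with hab | hab
  · exact ρ.rel_add hn hab h k
  · have h1 := ρ.rel_add hn hab (ρ.1.symm h) k
    exact ρ.1.trans h (ρ.1.trans h1 ((ρ.shift k b a).mp (ρ.1.symm h)))

/-- The right side depends only on the reduction of `ρ`. A nonzero multiple of `2n` moves `b` to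
distance at least `n` from `a` whenever `|a - b| < n`, so the block is translation-invariant unless
the relation was already `a ∼ b`. -/
theorem rel_iff_exists (hn : 0 < n) (ρ : TINC n) {a b : ℤ} :
    ρ.1 a b ↔ (∃ k : ℤ, ρ.1 a (b + 2 * n * k)) ∧
      (|a - b| < n ∨ ∃ k : ℤ, ρ.1 a (a + n + 2 * n * k)) := by
  have hfar : ∀ k : ℤ, k ≠ 0 → 2 * (n : ℤ) * k ≤ -(2 * n) ∨ 2 * (n : ℤ) ≤ 2 * n * k := by
    intro k hk
    rcases lt_or_gt_of_ne hk with h | h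
    · left; nlinarith
    · right; nlinarith
  constructor
  · intro h
    refine ⟨⟨0, by simpa using h⟩, ?_⟩
    by_cases hd : |a - b| < n
    · exact Or.inl hd
    · right
      refine ⟨0, ?_⟩
      have := ρ.rel_add_of_rel hn h (by
        rw [abs_lt] at hd
        omega) 1
      simpa using this
  · rintro ⟨⟨k, hk⟩, h⟩
    have hper : (∀ l : ℤ, ρ.1 a (a + l * n)) → ρ.1 a b := by
      intro hall
      have h1 := (ρ.shift_two (-k) _ _).mp hk
      have h2 : ρ.1 a (a + 2 * n * (-k)) := by
        have := hall (2 * (-k))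
        convert this using 1
        ring
      have h3 := ρ.1.trans h2 h1
      convert h3 using 1
      ring
    rcases h with h | ⟨l, hl⟩
    · by_cases hk0 : k = 0
      · simpa [hk0] using hk
      · refine hper (ρ.rel_add_of_rel hn hk ?_)
        rw [abs_lt] at h
        have := hfar k hk0
        omega
    · refine hper (ρ.rel_add_of_rel hn hl ?_)
      by_cases hl0 : l = 0
      · subst hl0
        left
        simp
      · have := hfar l hl0
        omega

end TINC

/-- The residue of an integer modulo `2n`, as an element of `[2n]`. -/
def segMod {n : ℕ} (hn : 0 < n) (a : ℤ) : Seg (2 * n) :=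
  ⟨(a - 1) % (2 * n) + 1, by
    have h1 := Int.emod_nonneg (a - 1) (show (2 * n : ℤ) ≠ 0 by omega)
    have h2 := Int.emod_lt_of_pos (a - 1) (show (0 : ℤ) < 2 * n by omega)
    constructor
    · omega
    · push_cast
      omega⟩

theorem exists_segMod {n : ℕ} (hn : 0 < n) (a : ℤ) :
    ∃ k : ℤ, a = segMod hn a + 2 * n * k := by
  refine ⟨(a - 1) / (2 * n), ?_⟩
  have := Int.emod_add_mul_ediv (a - 1) (2 * n)
  simp only [segMod]
  linarith

theorem seg_le {n : ℕ} (s : Seg (2 * n)) : (s : ℤ) ≤ 2 * n := by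
  have := s.2.2
  push_cast at this
  exact this

theorem seg_eq_of_add {n : ℕ} {s t : Seg (2 * n)} {k : ℤ} (h : (s : ℤ) = t + 2 * n * k) :
    s = t := by
  have hs := s.2.1
  have ht := t.2.1
  have hs' := seg_le s
  have ht' := seg_le t
  have h1 : k < 1 := by
    by_contra hk
    nlinarith
  have h2 : -1 < k := by
    by_contra hk
    nlinarith
  obtain rfl : k = 0 := by omega
  exact Subtype.ext (by simpa using h)

theorem segMod_eq {n : ℕ} (hn : 0 < n) {a : ℤ} {s : Seg (2 * n)} {k : ℤ}
    (h : a = s + 2 * n * k) : segMod hn a = s := by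
  obtain ⟨l, hl⟩ := exists_segMod hn a
  refine seg_eq_of_add (k := k - l) ?_
  rw [mul_sub]
  linarith

theorem segMod_add_mul {n : ℕ} (hn : 0 < n) (a k : ℤ) :
    segMod hn (a + 2 * n * k) = segMod hn a := by
  obtain ⟨l, hl⟩ := exists_segMod hn a
  refine segMod_eq hn (k := l + k) ?_
  rw [mul_add]
  linarith

theorem segMod_add {n : ℕ} (hn : 0 < n) (a : ℤ) : segMod hn (a + n) = rot (segMod hn a) := by
  obtain ⟨l, hl⟩ := exists_segMod hn a
  by_cases h : (segMod hn a : ℤ) ≤ n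
  · refine segMod_eq hn (k := l) ?_
    simp only [rot, if_pos h]
    linarith
  · refine segMod_eq hn (k := l + 1) ?_
    simp only [rot, if_neg h]
    linarith

theorem segMod_coe {n : ℕ} (hn : 0 < n) (s : Seg (2 * n)) : segMod hn s = s :=
  segMod_eq hn (k := 0) (by simp)

theorem TINC.reduce_segMod {n : ℕ} (hn : 0 < n) (ρ : TINC n) (a b : ℤ) :
    ρ.reduce.1 (segMod hn a) (segMod hn b) ↔ ∃ k : ℤ, ρ.1 a (b + 2 * n * k) := by
  obtain ⟨u, hu⟩ := exists_segMod hn a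
  obtain ⟨v, hv⟩ := exists_segMod hn b
  refine (ρ.redRel_iff _ _).trans ⟨?_, ?_⟩
  · rintro ⟨k, h⟩
    rw [ρ.shift_two u, ← hu] at h
    refine ⟨k + u - v, ?_⟩
    convert h using 1
    linear_combination hv
  · rintro ⟨k, h⟩
    refine ⟨k - u + v, ?_⟩
    rw [ρ.shift_two u, ← hu]
    convert h using 1
    linear_combination -hv

theorem TINC.reduce_injective {n : ℕ} (hn : 0 < n) :
    Function.Injective (TINC.reduce : TINC n → NCB n) := by
  intro ρ ρ' h
  apply Subtype.ext
  ext a b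
  change ρ.1 a b ↔ ρ'.1 a b
  rw [ρ.rel_iff_exists hn, ρ'.rel_iff_exists hn]
  simp only [← reduce_segMod hn]
  rw [h]

/-! ### The inverse of reduction -/

namespace NCB

variable {n : ℕ}

/-- The pull-back to `ℤ` of a partition of `[2n]`. -/
def lift (hn : 0 < n) (τ : NCB n) : Setoid ℤ := τ.1.comap (segMod hn)

theorem lift_iff (hn : 0 < n) (τ : NCB n) (a b : ℤ) :
    τ.lift hn a b ↔ τ.1 (segMod hn a) (segMod hn b) := Iff.rfl

theorem lift_add_mul (hn : 0 < n) (τ : NCB n) (a k : ℤ) : τ.lift hn a (a + 2 * n * k) := by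
  rw [lift_iff, segMod_add_mul]

theorem lift_add (hn : 0 < n) (τ : NCB n) (a b : ℤ) :
    τ.lift hn a b ↔ τ.lift hn (a + n) (b + n) := by
  rw [lift_iff, lift_iff, segMod_add, segMod_add]
  exact τ.2.2 _ _

theorem lift_noncrossing_seg (hn : 0 < n) (τ : NCB n) {a b c d : ℤ} (h0 : 1 ≤ a) (h1 : a < b)
    (h2 : b < c) (h3 : c < d) (h4 : d ≤ 2 * n) (hac : τ.lift hn a c) (hbd : τ.lift hn b d) :
    τ.lift hn a b := by
  have key : ∀ s : ℤ, 1 ≤ s → s ≤ 2 * n → (segMod hn s : ℤ) = s := by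
    intro s hs1 hs2
    have := segMod_coe hn (⟨s, hs1, by push_cast; exact hs2⟩ : Seg (2 * n))
    exact congrArg Subtype.val this
  refine τ.2.1 _ _ (segMod hn c) (segMod hn d) ?_ ?_ ?_ hac hbd <;>
  · rw [← Subtype.coe_lt_coe, key _ (by omega) (by omega), key _ (by omega) (by omega)]
    assumption

/-- Noncrossing is a cyclic condition, so it holds in every window of `2n` consecutive integers. The
cases record which of `b`, `c`, `d` pass `2n` once `a` is moved into `[1, 2n]`. -/
theorem lift_noncrossing (hn : 0 < n) (τ : NCB n) {a b c d : ℤ} (h1 : a < b) (h2 : b < c)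
    (h3 : c < d) (h4 : d < a + 2 * n) (hac : τ.lift hn a c) (hbd : τ.lift hn b d) :
    τ.lift hn a b := by
  set T := τ.lift hn with hT
  obtain ⟨k, hk⟩ := exists_segMod hn a
  have ha1 := (segMod hn a).2.1
  have ha2 := seg_le (segMod hn a)
  have hsh : ∀ s l : ℤ, T s (s + 2 * n * l) := τ.lift_add_mul hn
  have hsh2 : ∀ s t l : ℤ, T s t ↔ T (s + 2 * n * l) (t + 2 * n * l) := fun s t l =>
    ⟨fun h => T.trans (T.symm (hsh s l)) (T.trans h (hsh t l)),
      fun h => T.trans (hsh s l) (T.trans h (T.symm (hsh t l)))⟩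
  obtain ⟨b, rfl⟩ : ∃ b', b = b' + 2 * n * k := ⟨b - 2 * n * k, by ring⟩
  obtain ⟨c, rfl⟩ : ∃ b', c = b' + 2 * n * k := ⟨c - 2 * n * k, by ring⟩
  obtain ⟨d, rfl⟩ : ∃ b', d = b' + 2 * n * k := ⟨d - 2 * n * k, by ring⟩
  generalize (segMod hn a : ℤ) = a' at *
  rw [hk, ← hsh2] at hac ⊢
  rw [← hsh2] at hbd
  rw [hk] at h1 h4
  generalize 2 * (n : ℤ) * k = q at *
  have hback : ∀ s : ℤ, T s (s - 2 * n) := by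
    intro s
    have := hsh s (-1)
    convert this using 1
    ring
  have nc := @lift_noncrossing_seg n hn τ
  rw [← hT] at nc
  by_cases hd : d ≤ 2 * n
  · exact nc ha1 (by omega) (by omega) (by omega) hd hac hbd
  have hbd' := T.trans hbd (hback d)
  by_cases hc : c ≤ 2 * n
  · have := nc (a := d - 2 * n) (b := a') (c := b) (d := c) (by omega) (by omega) (by omega) (by omega) hc
      (T.symm hbd') hac
    exact T.symm (T.trans hbd' this)
  have hac' := T.trans hac (hback c)
  by_cases hb : b ≤ 2 * n
  · have := nc (a := c - 2 * n) (b := d - 2 * n) (c := a') (d := b) (by omega) (by omega) (by omega) (by omega) hb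
      (T.symm hac') (T.symm hbd')
    exact T.trans hac' (T.trans this (T.symm hbd'))
  · have := nc (a := b - 2 * n) (b := c - 2 * n) (c := d - 2 * n) (d := a') (by omega) (by omega) (by omega)
      (by omega) (by omega) (T.trans (T.symm (hback b)) hbd') (T.symm hac')
    exact T.symm (T.trans (hback b) (T.trans this (T.symm hac')))

theorem lift_half_congr (hn : 0 < n) (τ : NCB n) {a b : ℤ} (h : τ.lift hn a b)
    (ha : τ.lift hn a (a + n)) : τ.lift hn b (b + n) :=
  (τ.lift hn).trans ((τ.lift hn).symm h) ((τ.lift hn).trans ha ((τ.lift_add hn a b).mp h))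

theorem lift_half_mul (hn : 0 < n) (τ : NCB n) {a : ℤ} (ha : τ.lift hn a (a + n)) (k : ℤ) :
    τ.lift hn a (a + k * n) := by
  obtain ⟨m, rfl | rfl⟩ := Int.even_or_odd' k
  · have := τ.lift_add_mul hn a m
    convert this using 1
    ring
  · have := (τ.lift hn).trans ha (τ.lift_add_mul hn (a + n) m)
    convert this using 1
    ring

/-- This is the hard case of transitivity in `unreduce`: two short steps with a long sum. Unless `c
= a + n`, the pairs `b - n ∼ c - n` and `a ∼ b` cross, so the block is invariant under the half
turn. -/
theorem lift_trans_aux (hn : 0 < n) (τ : NCB n) {a b c : ℤ}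
    (h1 : b < a + n) (h2 : c < b + n) (h3 : a + n ≤ c) (hab' : τ.lift hn a b)
    (hbc' : τ.lift hn b c) : τ.lift hn a (a + n) := by
  set T := τ.lift hn with hT
  have hac : T a c := T.trans hab' hbc'
  rcases h3.eq_or_lt with e | hlt
  · rw [e]
    exact hac
  have h4 : T (b - n) (c - n) := by
    rw [hT, τ.lift_add hn, sub_add_cancel, sub_add_cancel]
    exact hbc'
  have h5 : T (b - n) a := τ.lift_noncrossing hn (a := b - n) (b := a) (c := c - n) (d := b)
    (by omega) (by omega) (by omega) (by omega) h4 hab'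
  have h6 := (τ.lift_add hn _ _).mp h5
  rw [sub_add_cancel] at h6
  exact T.trans hab' h6

/-- There is at most one centrally symmetric block: two diameters cross. -/
theorem lift_half_lift_half (hn : 0 < n) (τ : NCB n) {a b : ℤ} (ha : τ.lift hn a (a + n))
    (hb : τ.lift hn b (b + n)) : τ.lift hn a b := by
  set T := τ.lift hn with hT
  have h0 : (0 : ℤ) < n := by exact_mod_cast hn
  have h1 := Int.emod_nonneg (b - a) h0.ne'
  have h2 := Int.emod_lt_of_pos (b - a) h0
  have h3 := Int.emod_add_mul_ediv (b - a) n
  set r := (b - a) % n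
  set q := (b - a) / n
  have h4 : T b (a + r) := by
    have := τ.lift_half_mul hn hb (-q)
    convert this using 1
    linear_combination h3
  rcases h1.eq_or_lt with e | hr
  · rw [← e, add_zero] at h4
    exact T.symm h4
  · exact T.trans (τ.lift_noncrossing hn (a := a) (b := a + r) (c := a + n) (d := a + r + n)
      (by omega) (by omega) (by omega) (by omega) ha (τ.lift_half_congr hn h4 hb)) (T.symm h4)

/-- The translation-invariant noncrossing partition with a given reduction. -/
def unreduce (hn : 0 < n) (τ : NCB n) : TINC n :=
  ⟨{ r := fun a b => τ.lift hn a b ∧ (|a - b| < n ∨ τ.lift hn a (a + n))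
     iseqv := by
      refine ⟨fun a => ⟨(τ.lift hn).refl a, Or.inl (by simpa using hn)⟩, ?_, ?_⟩
      · rintro a b ⟨h1, h2⟩
        refine ⟨(τ.lift hn).symm h1, h2.imp (fun h => ?_) (τ.lift_half_congr hn h1)⟩
        rwa [abs_sub_comm]
      · rintro a b c ⟨h1, h2⟩ ⟨h3, h4⟩
        refine ⟨(τ.lift hn).trans h1 h3, ?_⟩
        rcases h2 with h2 | h2
        swap
        · exact Or.inr h2
        rcases h4 with h4 | h4
        swap
        · exact Or.inr (τ.lift_half_congr hn ((τ.lift hn).symm h1) h4)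
        by_cases hac : |a - c| < n
        · exact Or.inl hac
        right
        rw [abs_lt] at h2 h4 hac
        rcases lt_or_ge a c with h | h
        · exact τ.lift_trans_aux hn (b := b) (c := c) (by omega) (by omega) (by omega) h1 h3
        · have := τ.lift_trans_aux hn (a := c) (b := b) (c := a) (by omega) (by omega) (by omega)
            ((τ.lift hn).symm h3) ((τ.lift hn).symm h1)
          exact τ.lift_half_congr hn
            ((τ.lift hn).symm ((τ.lift hn).trans h1 h3)) this }, by
    constructor
    · rintro a b c d h1 h2 h3 ⟨hac, h4⟩ ⟨hbd, h5⟩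
      change τ.lift hn a b ∧ (|a - b| < n ∨ τ.lift hn a (a + n))
      set T := τ.lift hn with hT
      -- A long pair in a centrally symmetric block is replaced by a pair at distance `n`, so that
      -- all four points fit in one window of `2n` integers.
      by_cases ha : T a (a + n)
      · refine ⟨?_, Or.inr ha⟩
        by_cases hb : T b (b + n)
        · exact τ.lift_half_lift_half hn ha hb
        · have h5 := h5.resolve_right hb
          rw [abs_lt] at h5
          have hc := τ.lift_half_mul hn (τ.lift_half_congr hn hac ha) (-1)
          rw [← hT] at hc
          have := τ.lift_noncrossing hn (a := c + -1 * n) (b := b) (c := c) (d := d)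
            (by omega) (by omega) (by omega) (by omega) (T.symm hc) hbd
          exact T.trans hac (T.trans hc this)
      · have h4 := h4.resolve_right ha
        have h4' := abs_lt.mp h4
        have hlt : |a - b| < n := by
          rw [abs_lt]
          omega
        refine ⟨?_, Or.inl hlt⟩
        by_cases hb : T b (b + n)
        · exact τ.lift_noncrossing hn (a := a) (b := b) (c := c) (d := b + n)
            (by omega) (by omega) (by omega) (by omega) hac hb
        · have h5 := h5.resolve_right hb
          rw [abs_lt] at h5
          exact τ.lift_noncrossing hn (a := a) (b := b) (c := c) (d := d)
            (by omega) (by omega) (by omega) (by omega) hac hbd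
    · intro a b
      change (τ.lift hn a b ∧ (|a - b| < n ∨ τ.lift hn a (a + n))) ↔
        (τ.lift hn (a + n) (b + n) ∧ (|a + n - (b + n)| < n ∨ τ.lift hn (a + n) (a + n + n)))
      rw [← τ.lift_add hn, ← τ.lift_add hn, add_sub_add_right_eq_sub]⟩

theorem reduce_unreduce (hn : 0 < n) (τ : NCB n) : (τ.unreduce hn).reduce = τ := by
  apply Subtype.ext
  ext i j
  have hcoe : τ.1 i j ↔ τ.lift hn i j := by
    rw [lift_iff, segMod_coe, segMod_coe]
  change (τ.unreduce hn).RedRel i j ↔ τ.1 i j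
  rw [TINC.redRel_iff, hcoe]
  constructor
  · rintro ⟨k, h, -⟩
    exact (τ.lift hn).trans h ((τ.lift hn).symm (τ.lift_add_mul hn j k))
  · intro h
    -- Two points of a circle with `2n` positions have lifts at distance at most `n`; at distance
    -- exactly `n` the relation itself makes the block centrally symmetric.
    have key : ∀ k : ℤ, |(i : ℤ) - (j + 2 * n * k)| ≤ n →
        ∃ k : ℤ, (τ.unreduce hn).1 i (j + 2 * n * k) := by
      intro k hk
      have h' := (τ.lift hn).trans h (τ.lift_add_mul hn j k)
      refine ⟨k, h', ?_⟩
      rcases hk.eq_or_lt with e | hlt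
      · right
        rcases (abs_eq (by omega)).mp e with e | e
        · refine (τ.lift hn).trans h' ?_
          have : (j : ℤ) + 2 * n * k + 2 * n * 1 = i + n := by linarith
          rw [← this]
          exact τ.lift_add_mul hn _ 1
        · have : (j : ℤ) + 2 * n * k = i + n := by linarith
          rwa [this] at h'
      · exact Or.inl hlt
    have hi := i.2.1
    have hj := j.2.1
    have hi' := seg_le i
    have hj' := seg_le j
    by_cases h1 : (i : ℤ) - j ≤ n
    · by_cases h2 : -(n : ℤ) ≤ i - j
      · exact key 0 (by rw [abs_le]; constructor <;> linarith)
      · exact key (-1) (by rw [abs_le]; constructor <;> linarith)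
    · exact key 1 (by rw [abs_le]; constructor <;> linarith)

end NCB

theorem TINC.reduce_bijective {n : ℕ} (hn : 0 < n) :
    Function.Bijective (TINC.reduce : TINC n → NCB n) :=
  ⟨TINC.reduce_injective hn, fun τ => ⟨τ.unreduce hn, τ.reduce_unreduce hn⟩⟩

/-! ### Reduction commutes with the Kreweras complement -/

theorem SepRel.mem_iff {X : Type*} [LinearOrder X] {ρ : Setoid X} {i j : X} (h : SepRel ρ i j)
    (hij : i ≤ j) {x y : X} (hxy : ρ x y) : (i < x ∧ x ≤ j) ↔ (i < y ∧ y ≤ j) :=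
  ⟨fun h1 => (sepRel_iff hij).mp h x y hxy h1.1 h1.2,
    fun h1 => (sepRel_iff hij).mp h y x (ρ.symm hxy) h1.1 h1.2⟩

namespace TINC

variable {n : ℕ}

theorem krew_iff (ρ : TINC n) (i j : ℤ) : ρ.krew.1 i j ↔ SepRel ρ.1 i j := by
  change _root_.krew ρ.1 i j ↔ _
  rw [krew_eq ρ.2.1]
  rfl

theorem sepRel_shift (ρ : TINC n) {i j : ℤ} (k : ℤ) (h : SepRel ρ.1 i j) :
    SepRel ρ.1 (i + 2 * n * k) (j + 2 * n * k) := by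
  rw [← krew_iff] at h ⊢
  exact (ρ.krew.shift_two k i j).mp h

/-- The two hypotheses concern lifts of the two complementary arcs between `i` and `j`. Translates
by one turn handle related pairs whose lifts wrap around. -/
theorem sepRel_reduce_of (ρ : TINC n) {i j : Seg (2 * n)} (hij : i < j)
    (h : SepRel ρ.1 i j ∨ SepRel ρ.1 (j - 2 * n) i) : SepRel ρ.reduce.1 i j := by
  have hij' : (i : ℤ) < j := hij
  have hi := i.2.1
  have hj := seg_le j
  have main : ∀ x y : Seg (2 * n), x < y → ρ.RedRel x y →
      (((i : ℤ) < x ∧ (x : ℤ) ≤ j) ↔ ((i : ℤ) < y ∧ (y : ℤ) ≤ j)) := by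
    intro x y hlt hxy
    have hx := x.2.1
    have hx' := seg_le x
    have hy := y.2.1
    have hy' := seg_le y
    rcases h with h | h
    · rcases ρ.redRel_cases hlt hxy with h1 | h1
      · exact h.mem_iff hij'.le h1
      · have e1 := h.mem_iff hij'.le h1
        have e2 := (ρ.sepRel_shift (-1) h).mem_iff (by omega) h1
        clear h hxy h1
        omega
    · rcases ρ.redRel_cases hlt hxy with h1 | h1 <;>
      · have e1 := h.mem_iff (by omega) h1
        have e2 := (ρ.sepRel_shift (-1) h).mem_iff (by omega) h1
        have e3 := (ρ.sepRel_shift 1 h).mem_iff (by omega) h1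
        clear h hxy h1
        omega
  rw [sepRel_iff hij.le]
  intro x y hxy h1 h2
  rcases lt_trichotomy x y with hlt | rfl | hlt
  · exact (main x y hlt hxy).mp ⟨h1, h2⟩
  · exact ⟨h1, h2⟩
  · exact (main y x hlt (ρ.redRel_symm hxy)).mpr ⟨h1, h2⟩

theorem sepRel_of_reduce (hn : 0 < n) (ρ : TINC n) {i j : Seg (2 * n)} (hij : i < j)
    (h : SepRel ρ.reduce.1 i j) : SepRel ρ.1 i j ∨ SepRel ρ.1 (j - 2 * n) i := by
  have hij' : (i : ℤ) < j := hij
  have hi := i.2.1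
  have hj := seg_le j
  -- The union of all translates of `(i, j]` by multiples of `2n` is a union of blocks. It remains
  -- to show that single translates, or else single gaps, are too.
  have hS : ∀ x y k : ℤ, ρ.1 x y → (i : ℤ) + 2 * n * k < x → x ≤ (j : ℤ) + 2 * n * k →
      ∃ l : ℤ, (i : ℤ) + 2 * n * l < y ∧ y ≤ (j : ℤ) + 2 * n * l := by
    intro x y k hxy h1 h2
    obtain ⟨v, hv⟩ := exists_segMod hn y
    have hx : segMod hn x = ⟨x - 2 * n * k, by omega, by push_cast; omega⟩ :=
      segMod_eq hn (k := k) (by simp)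
    have h3 : ρ.reduce.1 (segMod hn x) (segMod hn y) :=
      (ρ.reduce_segMod hn x y).mpr ⟨0, by simpa using hxy⟩
    have h4 := (h.mem_iff hij.le h3).mp (by
      rw [hx]
      constructor
      · change (i : ℤ) < x - 2 * n * k
        omega
      · change x - 2 * n * k ≤ (j : ℤ)
        omega)
    have h5 : (i : ℤ) < segMod hn y := h4.1
    have h6 : (segMod hn y : ℤ) ≤ j := h4.2
    exact ⟨v, by omega, by omega⟩
  have hmul : ∀ k l : ℤ, k ≤ l → 2 * (n : ℤ) * k ≤ 2 * n * l := fun k l hkl =>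
    mul_le_mul_of_nonneg_left hkl (by positivity)
  have hsucc : ∀ k : ℤ, 2 * (n : ℤ) * (k + 1) = 2 * n * k + 2 * n := fun k => by ring
  have hgap : ∀ x : ℤ, ∃ l : ℤ, ((i : ℤ) + 2 * n * l < x ∧ x ≤ (j : ℤ) + 2 * n * l) ∨
      ((j : ℤ) + 2 * n * (l - 1) < x ∧ x ≤ (i : ℤ) + 2 * n * l) := by
    intro x
    obtain ⟨v, hv⟩ := exists_segMod hn x
    have h1 := (segMod hn x).2.1
    have h2 := seg_le (segMod hn x)
    have e1 := hsucc v
    have e2 := hsucc (v - 1)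
    rw [sub_add_cancel] at e2
    by_cases h3 : (segMod hn x : ℤ) ≤ i
    · exact ⟨v, Or.inr (by omega)⟩
    by_cases h4 : (segMod hn x : ℤ) ≤ j
    · exact ⟨v, Or.inl (by omega)⟩
    · exact ⟨v + 1, Or.inr (by rw [add_sub_cancel_right]; omega)⟩
  by_contra hcon
  push Not at hcon
  obtain ⟨hc1, hc2⟩ := hcon
  -- a related pair in two different translates of `(i, j]`
  have hA : ∃ x y k l : ℤ, k < l ∧ ρ.1 x y ∧ (i : ℤ) + 2 * n * k < x ∧ x ≤ (j : ℤ) + 2 * n * k ∧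
      (i : ℤ) + 2 * n * l < y ∧ y ≤ (j : ℤ) + 2 * n * l := by
    rw [sepRel_iff hij'.le] at hc1
    push Not at hc1
    obtain ⟨x, y, hxy, h1, h2, h3⟩ := hc1
    obtain ⟨l, h4, h5⟩ := hS x y 0 hxy (by simpa using h1) (by simpa using h2)
    rcases lt_trichotomy l 0 with hl | rfl | hl
    · exact ⟨y, x, l, 0, hl, ρ.1.symm hxy, h4, h5, by simpa using h1, by simpa using h2⟩
    · have := h3 (by simpa using h4)
      simp only [mul_zero, add_zero] at h5
      omega
    · exact ⟨x, y, 0, l, hl, hxy, by simpa using h1, by simpa using h2, h4, h5⟩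
  -- a related pair in two different gaps between these translates
  have hB : ∃ x y k l : ℤ, k < l ∧ ρ.1 x y ∧
      (j : ℤ) + 2 * n * (k - 1) < x ∧ x ≤ (i : ℤ) + 2 * n * k ∧
      (j : ℤ) + 2 * n * (l - 1) < y ∧ y ≤ (i : ℤ) + 2 * n * l := by
    have e1 : (j : ℤ) + 2 * n * (0 - 1) = j - 2 * n := by ring
    rw [sepRel_iff (by omega)] at hc2
    push Not at hc2
    obtain ⟨x, y, hxy, h1, h2, h3⟩ := hc2
    have h1' : (j : ℤ) + 2 * n * (0 - 1) < x := by rwa [e1]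
    have h2' : x ≤ i + 2 * n * 0 := by simpa using h2
    obtain ⟨l, h4 | h4⟩ := hgap y
    · exfalso
      obtain ⟨m, h5, h6⟩ := hS y x l (ρ.1.symm hxy) h4.1 h4.2
      rcases le_or_gt m (-1) with hm | hm
      · have := hmul m (-1) hm
        omega
      · have := hmul 0 m (by omega)
        omega
    · rcases lt_trichotomy l 0 with hl | rfl | hl
      · exact ⟨y, x, l, 0, hl, ρ.1.symm hxy, h4.1, h4.2, h1', h2'⟩
      · rw [e1] at h4
        have := h3 h4.1
        simp only [mul_zero, add_zero] at h4
        omega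
      · exact ⟨x, y, 0, l, hl, hxy, h1', h2', h4.1, h4.2⟩
  obtain ⟨x, y, k, l, hkl, hxy, a1, a2, a3, a4⟩ := hA
  obtain ⟨u, v, p, q, hpq, huv, b1, b2, b3, b4⟩ := hB
  -- The shift moves `u` into the gap just before translate `l`, and `v` beyond that translate. The
  -- two pairs now cross, relating a point of a translate to a point of a gap.
  have huv' := (ρ.shift_two (l - p) u v).mp huv
  have e1 : 2 * (n : ℤ) * (l - p) = 2 * n * l - 2 * n * p := by ring
  have e2 : ∀ m : ℤ, 2 * (n : ℤ) * (m - 1) = 2 * n * m - 2 * n := fun m => by ring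
  have e3 := hmul k (l - 1) (by omega)
  have e4 := hmul p (q - 1) (by omega)
  rw [e1] at huv'
  rw [e2] at b1 b3 e3 e4
  have hxu := ρ.2.1 x (u + (2 * n * l - 2 * n * p)) y (v + (2 * n * l - 2 * n * p))
    (by omega) (by omega) (by omega) hxy huv'
  obtain ⟨m, c1, c2⟩ := hS _ _ k hxu a1 a2
  rcases le_or_gt m (l - 1) with hm | hm
  · have := hmul m (l - 1) hm
    rw [e2] at this
    omega
  · have := hmul l m (by omega)
    omega

theorem reduce_krew (hn : 0 < n) (ρ : TINC n) : ρ.krew.reduce = ρ.reduce.krew := by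
  have key : ∀ i j : Seg (2 * n), i < j → (ρ.krew.RedRel i j ↔ SepRel ρ.reduce.1 i j) := by
    intro i j hij
    constructor
    · intro h
      refine ρ.sepRel_reduce_of hij ?_
      rw [← krew_iff, ← krew_iff]
      exact ρ.krew.redRel_cases hij h
    · intro h
      have := ρ.sepRel_of_reduce hn hij h
      rw [← krew_iff, ← krew_iff] at this
      rcases this with h | h
      · exact ρ.krew.redRel_of 0 0 (by ring) (by ring) h
      · exact ρ.krew.redRel_symm (ρ.krew.redRel_of (-1) 0 (by ring) (by ring) h)
  apply Subtype.ext
  ext i j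
  change ρ.krew.RedRel i j ↔ _root_.krew ρ.reduce.1 i j
  rw [krew_eq ρ.reduce.2.1]
  rcases lt_trichotomy i j with hij | rfl | hij
  · exact key i j hij
  · exact ⟨fun _ => (sepSetoid _).refl _, fun _ => ρ.krew.reduce.1.refl _⟩
  · exact ⟨fun h => (sepSetoid _).symm ((key j i hij).mp (ρ.krew.redRel_symm h)),
      fun h => ρ.krew.redRel_symm ((key j i hij).mpr ((sepSetoid _).symm h))⟩

end TINC

theorem mainTheorem10 (n : ℕ) (hn : 2 ≤ n) :
    Finite (CTam n) ∧ IsSemidistributive (CTam n) ∧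
    (∀ x : CTam n, IsNoncrossingArcDiagram n x.arcDiagram) ∧
    Function.Bijective (CTam.toTINC : CTam n → TINC n) ∧
    Function.Bijective (TINC.reduce : TINC n → NCB n) ∧
    ∃ Row : CTam n → CTam n,
      IsRowmotion Row ∧ (∀ f : CTam n → CTam n, IsRowmotion f → f = Row) ∧
      (∀ x : CTam n, (Row x).toTINC = x.toTINC.krew) ∧
      (∀ x : CTam n, (Row x).toTINC.reduce = x.toTINC.reduce.krew) ∧
      DynamicallyEquivalent Row (NCB.krew : NCB n → NCB n) := by
  have hn0 : 0 < n := by omega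
  have hP : Function.Bijective (CTam.toTINC : CTam n → TINC n) :=
    ⟨CTam.toTINC_injective hn0, CTam.toTINC_surjective⟩
  have hR := TINC.reduce_bijective hn0
  obtain ⟨Row, hRow, huniq, hkrew⟩ := CTam.exists_row hn0
  have hred : ∀ x : CTam n, (Row x).toTINC.reduce = x.toTINC.reduce.krew := fun x => by
    rw [hkrew, TINC.reduce_krew hn0]
  have hcomm : NCB.krew ∘ (TINC.reduce ∘ CTam.toTINC) = (TINC.reduce ∘ CTam.toTINC) ∘ Row :=
    funext fun x => (hred x).symm
  refine ⟨CTam.finite hn0, CTam.isSemidistributive hn0,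
    CTam.isNoncrossingArcDiagram_arcDiagram hn0, hP, hR, Row, hRow, huniq, hkrew, hred, hRow.1,
    ?_, _, hR.comp hP, hcomm⟩
  -- The Kreweras complement on `NCB n` is bijective because it is conjugate to `Row`.
  refine (Function.Bijective.of_comp_iff _ (hR.comp hP)).mp ?_
  rw [hcomm]
  exact (hR.comp hP).comp hRow.1
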